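/- Let $m$ be a half-integer, $m\in\mathbb Z+\tfrac12$ (or, more generally, any real number that is either a half-integer or satisfies $m\ge\tfrac12$). For real $a,\omega,\mu$ put $\xi=a\omega$, $\nu=a\mu$, and consider the angular eigenvalue problem of the Dirac equation in the Kerr--Newman geometry, for $S=(S^{(+)},S^{(-)})^{T}:(0,\pi)\to\mathbb C^2$, $$\frac{1}{2\sin\theta}\left\{2\begin{pmatrix}0&\sin\theta\\-\sin\theta&0\end{pmatrix}\frac{dS}{d\theta}+\begin{pmatrix}0&\cos\theta\\-\cos\theta&0\end{pmatrix}S+\begin{pmatrix}-2\nu\cos\theta\sin\theta&-2m+2\xi\sin^2\theta\\-2m+2\xi\sin^2\theta&2\nu\cos\theta\sin\theta\end{pmatrix}S\right\}=\lambda S .$$ A number $\lambda\in\mathbb C$ is an eigenvalue, with eigenfunction $S$, if $S$ is a differentiable solution on $(0,\pi)$ that does not vanish identically and whose components are square integrable with respect to $2\sin\theta\,d\theta$. Let $P_n^{(\alpha,\beta)}(x)=\sum_{s=0}^n\binom{n+\alpha}{n-s}\binom{n+\beta}{s}\left(\frac{x-1}2\right)^s\left(\frac{x+1}2\right)^{n-s}$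 denote the Jacobi polynomials. For $a=0$ the following hold. (1) The eigenvalues are exactly the numbers $$\lambda=\pm\left(n+\tfrac12+m\right),\qquad n\in\mathbb N_0,\quad n+2m\ge 0$$ (the condition $n+2m\ge0$ holds for every $n$ if $m>0$). (2) Let $n\in\mathbb N_0$ with $n+2m\ge0$, let $\varepsilon\in\{1,-1\}$ and $\lambda=\varepsilon(n+\tfrac12+m)$. The eigenfunctions for $\lambda$ are exactly the nonzero complex multiples of the function $S$ given on $(0,\pi)$ by $$\sqrt{\sin\theta}\,S(\theta)=\sin^{m+1/2}\theta\begin{pmatrix}\sqrt{\tan\frac\theta2}\;u(\cos\theta)\\ \sqrt{\cot\frac\theta2}\;v(\cos\theta)\end{pmatrix},\qquad u=\varepsilon P_n^{(m+1/2,\,m-1/2)},\quad v=-P_n^{(m-1/2,\,m+1/2)} .$$ (3) With $n,\varepsilon,\lambda$ as in (2) and $v=-P_n^{(m-1/2,m+1/2)}$, every function $u$ satisfying $(1+x)v'(x)=-(m+\tfrac12)v(x)-\lambda u(x)$ on $(-1,1)$ satisfies, for all $x\in(-1,1)$, $$\lambda u(x)=|\lambda|\,P_n^{(m+1/2,m-1/2)}(x),\qquad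 u(x)=\varepsilon P_n^{(m+1/2,m-1/2)}(x)=\pm P_n^{(m+1/2,m-1/2)}(x);$$ that is, $u=\pm P_n^{(\alpha+1,\beta-1)}$ with $\alpha=m-\tfrac12$, $\beta=m+\tfrac12$. -/

import Mathlib

open scoped Matrix

noncomputable section

/-- The Jacobi polynomial `P_n^{(α,β)}`, evaluated at `x`, for arbitrary real parameters:
`∑ s, C(n+α, n-s) C(n+β, s) ((x-1)/2)^s ((x+1)/2)^(n-s)`, with generalized binomial
coefficients `C(r, k) = r (r-1) ⋯ (r-k+1) / k!`. -/
def jacobiP (n : ℕ) (α β x : ℝ) : ℝ :=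
  ∑ s ∈ Finset.range (n + 1),
    Ring.choose ((n : ℝ) + α) (n - s) * Ring.choose ((n : ℝ) + β) s *
      ((x - 1) / 2) ^ s * ((x + 1) / 2) ^ (n - s)

/-- The angular Dirac operator in the Kerr-Newman geometry with rotation parameter `a`, for a
fermion of energy `ω`, mass `μ` and azimuthal number `m`, acting on two-component functions
`S = (S⁺, S⁻)` on `(0, π)`; with `ξ = a ω` and `ν = a μ` it is
`(1 / (2 sin θ)) (2 [0, sin θ; -sin θ, 0] S' + [0, cos θ; -cos θ, 0] S
  + [-2 ν cos θ sin θ, -2 m + 2 ξ sin² θ; -2 m + 2 ξ sin² θ, 2 ν cos θ sin θ] S)`. -/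
def angularOperator (a ω μ m : ℝ) (S : ℝ → Fin 2 → ℂ) (θ : ℝ) : Fin 2 → ℂ :=
  let s : ℂ := (Real.sin θ : ℝ)
  let c : ℂ := (Real.cos θ : ℝ)
  let ξ : ℂ := (a * ω : ℝ)
  let ν : ℂ := (a * μ : ℝ)
  (1 / (2 * s)) •
    ((2 : ℂ) • (!![0, s; -s, 0] *ᵥ deriv S θ) +
      !![0, c; -c, 0] *ᵥ S θ +
      !![-2 * ν * c * s, -2 * (m : ℂ) + 2 * ξ * s ^ 2;
         -2 * (m : ℂ) + 2 * ξ * s ^ 2, 2 * ν * c * s] *ᵥ S θ)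

/-- The measure `2 sin θ dθ` on `(0, π)`. -/
def angularMeasure : MeasureTheory.Measure ℝ :=
  (MeasureTheory.volume.restrict (Set.Ioo 0 Real.pi)).withDensity
    (fun θ => ENNReal.ofReal (2 * Real.sin θ))

/-- `S` is an eigenfunction of the angular operator with eigenvalue `z`: a differentiable solution
on `(0, π)` of the eigenvalue equation, not identically zero, whose components are square
integrable with respect to `2 sin θ dθ`. -/
structure IsAngularEigenfunction (a ω μ m : ℝ) (z : ℂ) (S : ℝ → Fin 2 → ℂ) : Prop where
  differentiableOn : DifferentiableOn ℝ S (Set.Ioo 0 Real.pi)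
  memLp : ∀ i, MeasureTheory.MemLp (fun θ => S θ i) 2 angularMeasure
  eigen : ∀ θ ∈ Set.Ioo 0 Real.pi, angularOperator a ω μ m S θ = z • S θ
  nonzero : ∃ θ ∈ Set.Ioo 0 Real.pi, S θ ≠ 0

/-- `z` is an eigenvalue of the angular operator. -/
def IsAngularEigenvalue (a ω μ m : ℝ) (z : ℂ) : Prop :=
  ∃ S : ℝ → Fin 2 → ℂ, IsAngularEigenfunction a ω μ m z S

/-- The two-component function `S` with
`√(sin θ) S(θ) = (sin θ)^(m+1/2) (√(tan (θ/2)) u(cos θ), √(cot (θ/2)) v(cos θ))`. -/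
def angularSpinor (m : ℝ) (u v : ℝ → ℝ) (θ : ℝ) : Fin 2 → ℂ :=
  ![(((√(Real.sin θ))⁻¹ * (Real.sin θ ^ (m + 1 / 2) *
        (√(Real.tan (θ / 2)) * u (Real.cos θ))) : ℝ) : ℂ),
    (((√(Real.sin θ))⁻¹ * (Real.sin θ ^ (m + 1 / 2) *
        (√(Real.cot (θ / 2)) * v (Real.cos θ))) : ℝ) : ℂ)]

end

/-!
For `a = 0` the function `ψ = √(sin θ) S` solves `ψ' = [-m / sin θ, -z; z, m / sin θ] ψ`, and the
weight of the measure turns into square integrability on `(0, π)`. The Wronskian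
`W = ψ₀ φ₁ - ψ₁ φ₀` of solutions with parameters `z` and `w` has derivative `(w - z) ψ ⬝ φ`. If `φ`
is one of the solutions `√(sin θ) S` in terms of Jacobi polynomials, here called modes, and
`m ≥ 1/2`, then `‖φ‖² ≲ sin θ`, so `‖W‖² / sin θ` is integrable and `W` vanishes at both ends:
solutions are orthogonal to all modes with a different parameter. Both components of the modes have
the form `q · (P_n ∘ cos)` with `q` independent of `n` and nonvanishing on `(0, π)`, and the `P_n`
span all polynomials, so by Weierstrass approximation a solution orthogonal to every mode is zero.
Hence the modes are the only solutions.

For negative half-integers `m`, exchanging the two components turns `(m, z)` into `(-m, -z)`, and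
the identity `P_{n+k+l}^{(-k,-l)} = ((x-1)/2)^k ((x+1)/2)^l P_n^{(k,l)}` matches the modes of the
two problems. It shifts the index by `-2m`, which is why only `n ≥ -2m` occurs.
-/

section Jacobi

theorem succ_mul_ringChoose_succ {R : Type*} [CommRing R] [BinomialRing R] (r : R) (k : ℕ) :
    ((k : R) + 1) * Ring.choose r (k + 1) = r * Ring.choose (r - 1) k := by
  simpa [nsmul_eq_mul] using Ring.choose_smul_choose r (n := k + 1) (k := 1) (by lia)

theorem succ_mul_ringChoose_succ' {R : Type*} [CommRing R] [BinomialRing R] (r : R) (k : ℕ) :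
    ((k : R) + 1) * Ring.choose r (k + 1) = Ring.choose r k * (r - k) := by
  simpa [nsmul_eq_mul] using Ring.choose_smul_choose r (n := k + 1) (k := k) (by lia)

theorem ringChoose_pos {r : ℝ} {k : ℕ} (h : (k : ℝ) < r + 1) : 0 < Ring.choose r k := by
  induction k with
  | zero => simp
  | succ k ih =>
    push_cast at h
    have hprod : 0 < Ring.choose r k * (r - k) := mul_pos (ih (by linarith)) (by linarith)
    rw [← succ_mul_ringChoose_succ'] at hprod
    exact pos_of_mul_pos_right hprod (by positivity)

/-- The coefficient of `((x - 1) / 2) ^ s * ((x + 1) / 2) ^ (n - s)` in the Jacobi polynomial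
`P_n^{(α,β)}`. -/
noncomputable def jacobiCoeff (n : ℕ) (α β : ℝ) (s : ℕ) : ℝ :=
  Ring.choose ((n : ℝ) + α) (n - s) * Ring.choose ((n : ℝ) + β) s

theorem jacobiCoeff_pos {n s : ℕ} {α β : ℝ} (hα : -1 < α) (hβ : -1 < β) (hs : s ≤ n) :
    0 < jacobiCoeff n α β s := by
  have hs' : (s : ℝ) ≤ n := mod_cast hs
  have hns : ((n - s : ℕ) : ℝ) ≤ n := mod_cast Nat.sub_le n s
  exact mul_pos (ringChoose_pos (by linarith)) (ringChoose_pos (by linarith))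

theorem mul_jacobiCoeff_self (n : ℕ) (α β : ℝ) :
    β * jacobiCoeff n α β n = (n + β) * jacobiCoeff n (α + 1) (β - 1) n := by
  have absorb := succ_mul_ringChoose_succ ((n : ℝ) + β) n
  have descend := succ_mul_ringChoose_succ' ((n : ℝ) + β) n
  simp only [jacobiCoeff, Nat.sub_self, Ring.choose_zero_right, one_mul, ← add_sub_assoc]
  linear_combination absorb - descend

theorem jacobiCoeff_add_jacobiCoeff_succ {n s : ℕ} (α β : ℝ) (hs : s < n) :
    ((n : ℝ) - s + β) * jacobiCoeff n α β s + ((s : ℝ) + 1) * jacobiCoeff n α β (s + 1) =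
      (n + β) * jacobiCoeff n (α + 1) (β - 1) s := by
  have absorb := succ_mul_ringChoose_succ ((n : ℝ) + β) s
  have descend := succ_mul_ringChoose_succ' ((n : ℝ) + β) s
  have pascal := Ring.choose_succ_succ ((n : ℝ) + α) (n - (s + 1))
  rw [show n - (s + 1) + 1 = n - s by lia] at pascal
  simp only [jacobiCoeff, ← add_sub_assoc, ← add_assoc, pascal]
  linear_combination Ring.choose ((n : ℝ) + α) (n - s) * (absorb - descend) +
    Ring.choose ((n : ℝ) + α) (n - (s + 1)) * absorb

theorem jacobiCoeff_neg_natCast (n k l s : ℕ) :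
    jacobiCoeff (n + k + l) (-k) (-l) s = (n + l).choose (n + k + l - s) * (n + k).choose s := by
  rw [jacobiCoeff, show ((n + k + l : ℕ) : ℝ) + -k = (n + l : ℕ) by push_cast; ring,
    show ((n + k + l : ℕ) : ℝ) + -l = (n + k : ℕ) by push_cast; ring,
    Ring.choose_natCast, Ring.choose_natCast]

theorem jacobiCoeff_add_neg_natCast {n s : ℕ} (k l : ℕ) (hs : s ≤ n) :
    jacobiCoeff (n + k + l) (-k) (-l) (k + s) = jacobiCoeff n k l s := by
  obtain ⟨t, rfl⟩ := Nat.exists_eq_add_of_le hs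
  rw [jacobiCoeff_neg_natCast, jacobiCoeff, ← Nat.cast_add, ← Nat.cast_add, Ring.choose_natCast,
    Ring.choose_natCast, show s + t + k + l - (k + s) = t + l by lia, Nat.add_sub_cancel_left,
    Nat.choose_symm_of_eq_add (show s + t + l = (t + l) + s by ring),
    Nat.choose_symm_of_eq_add (show s + t + k = (k + s) + t by ring), mul_comm]

theorem jacobiP_eq_sum (n : ℕ) (α β x : ℝ) :
    jacobiP n α β x = ∑ s ∈ Finset.range (n + 1),
      jacobiCoeff n α β s * (((x - 1) / 2) ^ s * ((x + 1) / 2) ^ (n - s)) := by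
  simp only [jacobiP, jacobiCoeff, mul_assoc]

theorem jacobiP_neg (n : ℕ) (α β x : ℝ) :
    jacobiP n α β (-x) = (-1) ^ n * jacobiP n β α x := by
  rw [jacobiP_eq_sum, jacobiP_eq_sum, ← Finset.sum_flip, Finset.mul_sum]
  refine Finset.sum_congr rfl fun s hs => ?_
  obtain ⟨t, rfl⟩ := Nat.exists_eq_add_of_le (Finset.mem_range_succ_iff.1 hs)
  simp only [jacobiCoeff, Nat.add_sub_cancel_left, Nat.add_sub_cancel]
  rw [show (-x - 1) / 2 = -1 * ((x + 1) / 2) by ring,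
    show (-x + 1) / 2 = -1 * ((x - 1) / 2) by ring, mul_pow, mul_pow, pow_add]
  ring

theorem jacobiP_neg_natCast (n k l : ℕ) (x : ℝ) :
    jacobiP (n + k + l) (-k) (-l) x =
      ((x - 1) / 2) ^ k * ((x + 1) / 2) ^ l * jacobiP n k l x := by
  have coeff_eq_zero_of_lt (s : ℕ) (hs : s < k) :
      jacobiCoeff (n + k + l) (-k) (-l) s = 0 := by
    rw [jacobiCoeff_neg_natCast, Nat.choose_eq_zero_of_lt (by lia), Nat.cast_zero, zero_mul]
  have coeff_eq_zero_of_gt (s : ℕ) : jacobiCoeff (n + k + l) (-k) (-l) (k + (n + 1 + s)) = 0 := by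
    rw [jacobiCoeff_neg_natCast, Nat.choose_eq_zero_of_lt (k := k + (n + 1 + s)) (by lia),
      Nat.cast_zero, mul_zero]
  rw [jacobiP_eq_sum, jacobiP_eq_sum, show n + k + l + 1 = k + (n + 1 + l) by ring,
    Finset.sum_range_add, Finset.sum_range_add, Finset.mul_sum,
    Finset.sum_eq_zero fun s hs => by rw [coeff_eq_zero_of_lt s (Finset.mem_range.1 hs), zero_mul],
    Finset.sum_eq_zero (s := Finset.range l) fun s _ => by rw [coeff_eq_zero_of_gt s, zero_mul],
    zero_add, add_zero]
  refine Finset.sum_congr rfl fun s hs => ?_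
  have hs' : s ≤ n := Finset.mem_range_succ_iff.1 hs
  rw [jacobiCoeff_add_neg_natCast k l hs', show n + k + l - (k + s) = l + (n - s) by lia]
  ring

theorem hasDerivAt_pow_mul_pow (s t : ℕ) (x : ℝ) :
    HasDerivAt (fun x : ℝ => ((x - 1) / 2) ^ s * ((x + 1) / 2) ^ t)
      (s * ((x - 1) / 2) ^ (s - 1) * (1 / 2) * ((x + 1) / 2) ^ t +
        ((x - 1) / 2) ^ s * (t * ((x + 1) / 2) ^ (t - 1) * (1 / 2))) x :=
  ((((hasDerivAt_id x).sub_const 1).div_const 2).fun_pow s).fun_mul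
    ((((hasDerivAt_id x).add_const 1).div_const 2).fun_pow t)

theorem one_add_mul_deriv_pow_mul_pow (s t : ℕ) (x : ℝ) :
    (1 + x) * deriv (fun x : ℝ => ((x - 1) / 2) ^ s * ((x + 1) / 2) ^ t) x =
      s * (((x - 1) / 2) ^ (s - 1) * ((x + 1) / 2) ^ (t + 1)) +
        t * (((x - 1) / 2) ^ s * ((x + 1) / 2) ^ t) := by
  rw [(hasDerivAt_pow_mul_pow s t x).deriv]
  rcases t with _ | t
  · simp; ring
  · rw [Nat.add_sub_cancel]; ring

theorem differentiable_jacobiP (n : ℕ) (α β : ℝ) : Differentiable ℝ (jacobiP n α β) := by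
  unfold jacobiP
  fun_prop

theorem one_add_mul_deriv_jacobiP (n : ℕ) (α β x : ℝ) :
    (1 + x) * deriv (jacobiP n α β) x + β * jacobiP n α β x =
      (n + β) * jacobiP n (α + 1) (β - 1) x := by
  set A : ℝ := (x - 1) / 2
  set B : ℝ := (x + 1) / 2
  have deriv_eq : deriv (jacobiP n α β) x = ∑ s ∈ Finset.range (n + 1),
      jacobiCoeff n α β s * deriv (fun x : ℝ => ((x - 1) / 2) ^ s * ((x + 1) / 2) ^ (n - s)) x := by
    rw [funext (jacobiP_eq_sum n α β), deriv_fun_sum fun s _ => by fun_prop]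
    exact Finset.sum_congr rfl fun s _ => deriv_const_mul _ (by fun_prop)
  calc (1 + x) * deriv (jacobiP n α β) x + β * jacobiP n α β x
      = ∑ s ∈ Finset.range (n + 1), (s * jacobiCoeff n α β s * (A ^ (s - 1) * B ^ (n - s + 1)) +
          ((n : ℝ) - s + β) * jacobiCoeff n α β s * (A ^ s * B ^ (n - s))) := by
        rw [deriv_eq, jacobiP_eq_sum, Finset.mul_sum, Finset.mul_sum, ← Finset.sum_add_distrib]
        refine Finset.sum_congr rfl fun s hs => ?_
        rw [mul_left_comm, one_add_mul_deriv_pow_mul_pow,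
          Nat.cast_sub (Finset.mem_range_succ_iff.1 hs)]
        ring
    _ = ∑ s ∈ Finset.range n, (((n : ℝ) - s + β) * jacobiCoeff n α β s +
          ((s : ℝ) + 1) * jacobiCoeff n α β (s + 1)) * (A ^ s * B ^ (n - s)) +
        β * jacobiCoeff n α β n * (A ^ n * B ^ (n - n)) := by
        rw [Finset.sum_add_distrib, Finset.sum_range_succ', Finset.sum_range_succ _ n,
          Nat.cast_zero, zero_mul, zero_mul, add_zero, ← add_assoc, ← Finset.sum_add_distrib,
          sub_self, zero_add]
        congr 1
        refine Finset.sum_congr rfl fun s hs => ?_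
        rw [show n - (s + 1) + 1 = n - s by have := Finset.mem_range.1 hs; lia,
          Nat.add_sub_cancel]
        push_cast
        ring
    _ = (n + β) * jacobiP n (α + 1) (β - 1) x := by
        rw [jacobiP_eq_sum, Finset.mul_sum, Finset.sum_range_succ _ n, mul_jacobiCoeff_self,
          mul_assoc]
        congr 1
        refine Finset.sum_congr rfl fun s hs => ?_
        rw [jacobiCoeff_add_jacobiCoeff_succ α β (Finset.mem_range.1 hs), mul_assoc]

open Polynomial in
/-- The Jacobi polynomial `P_n^{(α,β)}` as an element of `ℝ[X]`. -/
noncomputable def jacobiPoly (n : ℕ) (α β : ℝ) : ℝ[X] :=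
  ∑ s ∈ Finset.range (n + 1),
    C (jacobiCoeff n α β s * (1 / 2) ^ n) * ((X - C 1) ^ s * (X + C 1) ^ (n - s))

theorem eval_jacobiPoly (n : ℕ) (α β x : ℝ) : (jacobiPoly n α β).eval x = jacobiP n α β x := by
  rw [jacobiP_eq_sum, jacobiPoly, Polynomial.eval_finsetSum]
  refine Finset.sum_congr rfl fun s hs => ?_
  obtain ⟨t, rfl⟩ := Nat.exists_eq_add_of_le (Finset.mem_range_succ_iff.1 hs)
  simp only [Polynomial.eval_mul, Polynomial.eval_C, Polynomial.eval_pow, Polynomial.eval_sub,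
    Polynomial.eval_add, Polynomial.eval_X, Nat.add_sub_cancel_left, div_pow, pow_add]
  ring

open Polynomial in
theorem isMonicOfDegree_X_sub_C_pow_mul_X_add_C_pow {R : Type*} [CommRing R] [Nontrivial R]
    (a b : R) (s t : ℕ) :
    IsMonicOfDegree ((X - C a) ^ s * (X + C b) ^ t) (s + t) := by
  simpa using ((isMonicOfDegree_X_sub_one a).pow s).mul ((isMonicOfDegree_X_add_one b).pow t)

open Polynomial in
theorem degree_jacobiPoly (n : ℕ) {α β : ℝ} (hα : -1 < α) (hβ : -1 < β) :
    (jacobiPoly n α β).degree = n := by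
  have monic (s : ℕ) (hs : s ∈ Finset.range (n + 1)) :
      IsMonicOfDegree ((X - C (1 : ℝ)) ^ s * (X + C 1) ^ (n - s)) n := by
    simpa only [Nat.add_sub_of_le (Finset.mem_range_succ_iff.1 hs)] using
      isMonicOfDegree_X_sub_C_pow_mul_X_add_C_pow (1 : ℝ) 1 s (n - s)
  refine degree_eq_of_le_of_coeff_ne_zero ?_ ?_
  · refine (degree_sum_le _ _).trans (Finset.sup_le fun s hs => ?_)
    exact degree_le_of_natDegree_le ((natDegree_C_mul_le _ _).trans (monic s hs).natDegree_eq.le)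
  · rw [jacobiPoly, finsetSum_coeff]
    refine (Finset.sum_pos (fun s hs => ?_) ⟨0, by simp⟩).ne'
    have lead := (monic s hs).monic.coeff_natDegree
    rw [(monic s hs).natDegree_eq] at lead
    rw [coeff_C_mul, lead, mul_one]
    exact mul_pos (jacobiCoeff_pos hα hβ (Finset.mem_range_succ_iff.1 hs)) (by positivity)

theorem span_range_jacobiPoly {α β : ℝ} (hα : -1 < α) (hβ : -1 < β) :
    Submodule.span ℝ (Set.range fun n => jacobiPoly n α β) = ⊤ := by
  let S : Polynomial.Sequence ℝ :=
    { elems' := fun n => jacobiPoly n α β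
      degree_eq' := fun n => degree_jacobiPoly n hα hβ }
  exact S.span fun n => (Polynomial.leadingCoeff_ne_zero.2 (S.ne_zero n)).isUnit

end Jacobi

section Completeness

open MeasureTheory Set

variable {Ω E : Type*} {mΩ : MeasurableSpace Ω} [NormedAddCommGroup E] [NormedSpace ℝ E]
  {ν : Measure Ω} {X : Ω → ℝ} {k : Ω → E} {a b : ℝ} {φ : ℝ → ℝ}

theorem integrable_comp_smul_of_continuous (hX : Measurable X) (hmem : ∀ᵐ t ∂ν, X t ∈ Icc a b)
    (hk : Integrable k ν) (hφ : Continuous φ) : Integrable (fun t => φ (X t) • k t) ν := by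
  obtain ⟨C, hC⟩ := isCompact_Icc.exists_bound_of_continuousOn (hφ.continuousOn (s := Icc a b))
  refine hk.bdd_smul C (hφ.measurable.comp hX).aestronglyMeasurable ?_
  filter_upwards [hmem] with t ht using hC _ ht

theorem integral_comp_smul_eq_zero_of_forall_polynomial (hX : Measurable X)
    (hmem : ∀ᵐ t ∂ν, X t ∈ Icc a b) (hk : Integrable k ν)
    (h : ∀ p : Polynomial ℝ, ∫ t, p.eval (X t) • k t ∂ν = 0) (hφ : Continuous φ) :
    ∫ t, φ (X t) • k t ∂ν = 0 := by
  have norm_integral_le {ε : ℝ} (hε : 0 < ε) :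
      ‖∫ t, φ (X t) • k t ∂ν‖ ≤ ε * ∫ t, ‖k t‖ ∂ν := by
    obtain ⟨p, hp⟩ := exists_polynomial_near_of_continuousOn a b φ hφ.continuousOn ε hε
    have sub_approx : ∫ t, φ (X t) • k t ∂ν = ∫ t, (φ (X t) - p.eval (X t)) • k t ∂ν := by
      simp only [sub_smul]
      rw [integral_sub (integrable_comp_smul_of_continuous hX hmem hk hφ)
        (integrable_comp_smul_of_continuous hX hmem hk p.continuous), h p, sub_zero]
    rw [sub_approx, ← integral_const_mul]
    refine norm_integral_le_of_norm_le (hk.norm.const_mul ε) ?_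
    filter_upwards [hmem] with t ht
    rw [norm_smul, Real.norm_eq_abs, abs_sub_comm]
    gcongr
    exact (hp _ ht).le
  have tendsto_bound : Filter.Tendsto (fun ε : ℝ => ε * ∫ t, ‖k t‖ ∂ν) (nhdsWithin 0 (Ioi 0))
      (nhds 0) := by
    simpa using ((continuous_mul_const (∫ t, ‖k t‖ ∂ν)).tendsto 0).mono_left nhdsWithin_le_nhds
  exact norm_le_zero_iff.1 <| ge_of_tendsto tendsto_bound <|
    eventually_nhdsWithin_of_forall fun _ => norm_integral_le

theorem integral_polynomial_smul_eq_zero_of_forall_jacobiP {α β : ℝ} (hα : -1 < α) (hβ : -1 < β)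
    (hX : Measurable X) (hmem : ∀ᵐ t ∂ν, X t ∈ Icc a b) (hk : Integrable k ν)
    (h : ∀ n, ∫ t, jacobiP n α β (X t) • k t ∂ν = 0) (p : Polynomial ℝ) :
    ∫ t, p.eval (X t) • k t ∂ν = 0 := by
  have hp : p ∈ Submodule.span ℝ (range fun n => jacobiPoly n α β) := by
    rw [span_range_jacobiPoly hα hβ]
    exact Submodule.mem_top
  induction hp using Submodule.span_induction with
  | mem q hq =>
    obtain ⟨n, rfl⟩ := hq
    simpa only [eval_jacobiPoly] using h n
  | zero => simp
  | add q r _ _ hq hr =>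
    simp only [Polynomial.eval_add, add_smul]
    rw [integral_add (integrable_comp_smul_of_continuous hX hmem hk q.continuous)
      (integrable_comp_smul_of_continuous hX hmem hk r.continuous), hq, hr, add_zero]
  | smul c q _ hq =>
    simp only [Polynomial.eval_smul, smul_assoc]
    rw [integral_smul, hq, smul_zero]

theorem eqOn_zero_of_forall_integral_jacobiP_cos [CompleteSpace E] {α β : ℝ} (hα : -1 < α)
    (hβ : -1 < β) {f : ℝ → E} (hf : IntegrableOn f (Ioo 0 Real.pi))
    (hcont : ContinuousOn f (Ioo 0 Real.pi))
    (h : ∀ n, ∫ θ in Ioo 0 Real.pi, jacobiP n α β (Real.cos θ) • f θ = 0) :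
    EqOn f 0 (Ioo 0 Real.pi) := by
  have hmem : ∀ᵐ θ ∂volume.restrict (Ioo 0 Real.pi), Real.cos θ ∈ Icc (-1) 1 :=
    .of_forall Real.cos_mem_Icc
  have polynomial := integral_polynomial_smul_eq_zero_of_forall_jacobiP hα hβ
    Real.measurable_cos hmem hf h
  have ae_zero : ∀ᵐ θ ∂volume, θ ∈ Ioo 0 Real.pi → f θ = 0 := by
    refine isOpen_Ioo.ae_eq_zero_of_integral_contDiff_smul_eq_zero hf.locallyIntegrableOn ?_
    intro g hg _ hsupp
    calc ∫ θ, g θ • f θ = ∫ θ in Ioo 0 Real.pi, g θ • f θ :=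
          (setIntegral_eq_integral_of_forall_compl_eq_zero fun θ hθ => by
            rw [image_eq_zero_of_notMem_tsupport fun h => hθ (hsupp h), zero_smul]).symm
      _ = ∫ θ in Ioo 0 Real.pi, g (Real.arccos (Real.cos θ)) • f θ :=
          setIntegral_congr_fun measurableSet_Ioo fun θ hθ => by
            simp only [Real.arccos_cos hθ.1.le hθ.2.le]
      _ = 0 := integral_comp_smul_eq_zero_of_forall_polynomial Real.measurable_cos hmem hf
          polynomial (φ := fun x => g (Real.arccos x)) (by fun_prop)
  exact Measure.eqOn_open_of_ae_eq ((ae_restrict_iff' measurableSet_Ioo).2 ae_zero) isOpen_Ioo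
    hcont continuousOn_const

end Completeness

section Modes

open Set

theorem exists_mem_Ioo_jacobiP_ne_zero (n : ℕ) {α β a b : ℝ} (hα : -1 < α) (hβ : -1 < β)
    (hab : a < b) : ∃ x ∈ Ioo a b, jacobiP n α β x ≠ 0 := by
  have ne_zero : jacobiPoly n α β ≠ 0 := fun h => by
    simpa [h] using degree_jacobiPoly n hα hβ
  by_contra! hzero
  exact ne_zero <| Polynomial.eq_zero_of_infinite_isRoot _ <| (Ioo_infinite hab).mono fun x hx =>
    (eval_jacobiPoly n α β x).trans (hzero x hx)

/-- The function `sin^m θ √(1 - cos θ) P_n^{(m+1/2, m-1/2)}(cos θ)`, which is up to sign the first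
component of `√(sin θ) S(θ)` for the eigenfunctions `S` with index `n`. -/
noncomputable def angularFst (m : ℝ) (n : ℕ) (θ : ℝ) : ℝ :=
  Real.sin θ ^ m * √(1 - Real.cos θ) * jacobiP n (m + 1 / 2) (m - 1 / 2) (Real.cos θ)

/-- The function `sin^m θ √(1 + cos θ) P_n^{(m-1/2, m+1/2)}(cos θ)`, which is up to sign the second
component of `√(sin θ) S(θ)` for the eigenfunctions `S` with index `n`. -/
noncomputable def angularSnd (m : ℝ) (n : ℕ) (θ : ℝ) : ℝ :=
  Real.sin θ ^ m * √(1 + Real.cos θ) * jacobiP n (m - 1 / 2) (m + 1 / 2) (Real.cos θ)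

theorem angularSnd_pi_sub (m : ℝ) (n : ℕ) (θ : ℝ) :
    angularSnd m n (Real.pi - θ) = (-1) ^ n * angularFst m n θ := by
  rw [angularSnd, angularFst, Real.sin_pi_sub, Real.cos_pi_sub, jacobiP_neg, ← sub_eq_add_neg]
  ring

theorem angularFst_pi_sub (m : ℝ) (n : ℕ) (θ : ℝ) :
    angularFst m n (Real.pi - θ) = (-1) ^ n * angularSnd m n θ := by
  rw [angularSnd, angularFst, Real.sin_pi_sub, Real.cos_pi_sub, jacobiP_neg, sub_neg_eq_add]
  ring

theorem pi_sub_mem_Ioo {θ : ℝ} (hθ : θ ∈ Ioo 0 Real.pi) : Real.pi - θ ∈ Ioo 0 Real.pi :=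
  ⟨sub_pos.2 hθ.2, sub_lt_self _ hθ.1⟩

theorem cos_mem_Ioo {θ : ℝ} (hθ : θ ∈ Ioo 0 Real.pi) : Real.cos θ ∈ Ioo (-1 : ℝ) 1 := by
  have hs := Real.sin_pos_of_mem_Ioo hθ
  exact abs_lt.1 (sq_lt_one_iff_abs_lt_one _ |>.1 (by nlinarith [Real.sin_sq_add_cos_sq θ]))

theorem sqrt_one_sub_cos_mul_sqrt_one_add_cos {θ : ℝ} (hθ : 0 ≤ Real.sin θ) :
    √(1 - Real.cos θ) * √(1 + Real.cos θ) = Real.sin θ := by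
  rw [← Real.sqrt_mul (by linarith [Real.cos_le_one θ]), ← Real.sqrt_sq hθ, Real.sin_sq]
  ring_nf

theorem hasDerivAt_sqrt_one_add_cos {θ : ℝ} (hθ : θ ∈ Ioo 0 Real.pi) :
    HasDerivAt (fun θ => √(1 + Real.cos θ)) (-(√(1 - Real.cos θ) / 2)) θ := by
  have hcos := cos_mem_Ioo hθ
  have hpos : 0 < √(1 + Real.cos θ) := Real.sqrt_pos.2 (by linarith [hcos.1])
  convert ((Real.hasDerivAt_cos θ).const_add 1).sqrt (by linarith [hcos.1]) using 1
  rw [← sqrt_one_sub_cos_mul_sqrt_one_add_cos (Real.sin_pos_of_mem_Ioo hθ).le]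
  field_simp

theorem hasDerivAt_sin_rpow (m : ℝ) {θ : ℝ} (hθ : Real.sin θ ≠ 0) :
    HasDerivAt (fun θ => Real.sin θ ^ m) (Real.sin θ ^ m * (m * Real.cos θ / Real.sin θ)) θ := by
  convert (Real.hasDerivAt_sin θ).rpow_const (p := m) (Or.inl hθ) using 1
  rw [Real.rpow_sub_one hθ]
  ring

theorem hasDerivAt_angularSnd (m : ℝ) (n : ℕ) {θ : ℝ} (hθ : θ ∈ Ioo 0 Real.pi) :
    HasDerivAt (angularSnd m n)
      (m / Real.sin θ * angularSnd m n θ - (n + 1 / 2 + m) * angularFst m n θ) θ := by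
  have hs := Real.sin_pos_of_mem_Ioo hθ
  refine (((hasDerivAt_sin_rpow m hs.ne').mul (hasDerivAt_sqrt_one_add_cos hθ)).mul
    ((differentiable_jacobiP n (m - 1 / 2) (m + 1 / 2) (Real.cos θ)).hasDerivAt.comp θ
      (Real.hasDerivAt_cos θ))).congr_deriv ?_
  have ladder := one_add_mul_deriv_jacobiP n (m - 1 / 2) (m + 1 / 2) (Real.cos θ)
  rw [show m - 1 / 2 + 1 = m + 1 / 2 by ring, show m + 1 / 2 - 1 = m - 1 / 2 by ring] at ladder
  have sqrt_mul_sqrt := sqrt_one_sub_cos_mul_sqrt_one_add_cos hs.le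
  have sq_fst := Real.sq_sqrt (sub_nonneg.2 (Real.cos_le_one θ))
  have sq_snd := Real.sq_sqrt (neg_le_iff_add_nonneg'.1 (Real.neg_one_le_cos θ))
  simp only [Function.comp, Pi.mul_apply, angularFst, angularSnd]
  generalize √(1 - Real.cos θ) = p at *
  generalize √(1 + Real.cos θ) = q at *
  generalize deriv (jacobiP n (m - 1 / 2) (m + 1 / 2)) (Real.cos θ) = D at *
  generalize jacobiP n (m - 1 / 2) (m + 1 / 2) (Real.cos θ) = Q at *
  generalize jacobiP n (m + 1 / 2) (m - 1 / 2) (Real.cos θ) = P at *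
  have deriv_term : q * (D * Real.sin θ) = p * ((n + (m + 1 / 2)) * P - (m + 1 / 2) * Q) := by
    linear_combination p * ladder + p * D * sq_snd - q * D * sqrt_mul_sqrt
  have angle_term : q * Real.cos θ / Real.sin θ = q / Real.sin θ - p := by
    field_simp
    linear_combination q * sq_fst - p * sqrt_mul_sqrt
  linear_combination Real.sin θ ^ m * m * Q * angle_term - Real.sin θ ^ m * deriv_term

theorem hasDerivAt_angularFst (m : ℝ) (n : ℕ) {θ : ℝ} (hθ : θ ∈ Ioo 0 Real.pi) :
    HasDerivAt (angularFst m n)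
      (-(m / Real.sin θ) * angularFst m n θ + (n + 1 / 2 + m) * angularSnd m n θ) θ := by
  have sign_mul_self : (-1 : ℝ) ^ n * (-1) ^ n = 1 := pow_mul_pow_eq_one n (by norm_num)
  have fst_eq : angularFst m n = fun θ => (-1) ^ n * angularSnd m n (Real.pi - θ) := by
    funext θ
    rw [angularSnd_pi_sub, ← mul_assoc, sign_mul_self, one_mul]
  have deriv_snd := ((hasDerivAt_angularSnd m n (pi_sub_mem_Ioo hθ)).comp θ
    ((hasDerivAt_id θ).const_sub Real.pi)).const_mul ((-1) ^ n)
  rw [angularSnd_pi_sub, angularFst_pi_sub, Real.sin_pi_sub] at deriv_snd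
  rw [fst_eq]
  refine deriv_snd.congr_deriv ?_
  simp only [angularSnd_pi_sub]
  linear_combination (n + 1 / 2 + m) * angularSnd m n θ * sign_mul_self

theorem angularSnd_neg (n k : ℕ) {θ : ℝ} (hθ : θ ∈ Ioo 0 Real.pi) :
    angularSnd (-((k : ℝ) + 1 / 2)) (n + (2 * k + 1)) θ =
      (-1) ^ (k + 1) * (1 / 2) ^ (2 * k + 1) * angularFst (k + 1 / 2) n θ := by
  have hs := Real.sin_pos_of_mem_Ioo hθ
  have sin_rpow : Real.sin θ ^ ((k : ℝ) + 1 / 2) =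
      Real.sin θ ^ (-((k : ℝ) + 1 / 2)) * Real.sin θ ^ (2 * k + 1) := by
    rw [← Real.rpow_natCast, ← Real.rpow_add hs]
    push_cast
    ring_nf
  have sqrt_mul_sqrt := sqrt_one_sub_cos_mul_sqrt_one_add_cos hs.le
  have sq_fst := Real.sq_sqrt (sub_nonneg.2 (Real.cos_le_one θ))
  have factors : √(1 + Real.cos θ) * ((1 - Real.cos θ) ^ (k + 1) * (1 + Real.cos θ) ^ k) =
      Real.sin θ ^ (2 * k + 1) * √(1 - Real.cos θ) := by
    rw [pow_succ, mul_right_comm, ← mul_pow, show (1 - Real.cos θ) * (1 + Real.cos θ) =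
      Real.sin θ ^ 2 by rw [Real.sin_sq]; ring, ← pow_mul, pow_succ _ (2 * k)]
    linear_combination Real.sin θ ^ (2 * k) *
      (√(1 - Real.cos θ) * sqrt_mul_sqrt - √(1 + Real.cos θ) * sq_fst)
  have jacobi := jacobiP_neg_natCast n (k + 1) k (Real.cos θ)
  rw [show n + (k + 1) + k = n + (2 * k + 1) by ring, Nat.cast_succ] at jacobi
  rw [angularSnd, angularFst, show -((k : ℝ) + 1 / 2) - 1 / 2 = -(k + 1) by ring,
    show -((k : ℝ) + 1 / 2) + 1 / 2 = -k by ring, jacobi, sin_rpow,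
    show (k : ℝ) + 1 / 2 + 1 / 2 = k + 1 by ring, show (k : ℝ) + 1 / 2 - 1 / 2 = k by ring,
    show (Real.cos θ - 1) / 2 = -1 * (1 / 2) * (1 - Real.cos θ) by ring,
    show (Real.cos θ + 1) / 2 = 1 / 2 * (1 + Real.cos θ) by ring, mul_pow, mul_pow, mul_pow]
  linear_combination Real.sin θ ^ (-((k : ℝ) + 1 / 2)) * (-1) ^ (k + 1) * (1 / 2) ^ (2 * k + 1) *
    jacobiP n (k + 1) k (Real.cos θ) * factors

theorem angularFst_neg (n k : ℕ) {θ : ℝ} (hθ : θ ∈ Ioo 0 Real.pi) :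
    angularFst (-((k : ℝ) + 1 / 2)) (n + (2 * k + 1)) θ =
      (-1) ^ k * (1 / 2) ^ (2 * k + 1) * angularSnd (k + 1 / 2) n θ := by
  have h := angularSnd_neg n k (pi_sub_mem_Ioo hθ)
  rw [angularSnd_pi_sub, angularFst_pi_sub, pow_add _ n, Odd.neg_one_pow ⟨k, rfl⟩] at h
  refine mul_left_cancel₀ (pow_ne_zero n (neg_ne_zero.2 one_ne_zero)) ?_
  linear_combination -h

theorem exists_abs_angularSnd_le {m : ℝ} (hm : 1 / 2 ≤ m) (n : ℕ) :
    ∃ C : ℝ, ∀ θ ∈ Ioo 0 Real.pi, |angularSnd m n θ| ≤ C * √(Real.sin θ) := by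
  have hjacobi := (differentiable_jacobiP n (m - 1 / 2) (m + 1 / 2)).continuous
  obtain ⟨C, hC⟩ := (isCompact_Icc (a := 0) (b := Real.pi)).exists_bound_of_continuousOn
    (f := fun θ => √(1 + Real.cos θ) * jacobiP n (m - 1 / 2) (m + 1 / 2) (Real.cos θ))
    (by fun_prop)
  refine ⟨C, fun θ hθ => ?_⟩
  have hs := Real.sin_pos_of_mem_Ioo hθ
  have sin_rpow_le : Real.sin θ ^ m ≤ √(Real.sin θ) := by
    rw [Real.sqrt_eq_rpow]
    exact Real.rpow_le_rpow_of_exponent_ge hs (Real.sin_le_one θ) hm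
  rw [angularSnd, mul_assoc, abs_mul, abs_of_pos (Real.rpow_pos_of_pos hs m), mul_comm C]
  exact mul_le_mul sin_rpow_le (hC θ (Ioo_subset_Icc_self hθ)) (abs_nonneg _) (Real.sqrt_nonneg _)

theorem exists_abs_angularFst_le {m : ℝ} (hm : 1 / 2 ≤ m) (n : ℕ) :
    ∃ C : ℝ, ∀ θ ∈ Ioo 0 Real.pi, |angularFst m n θ| ≤ C * √(Real.sin θ) := by
  obtain ⟨C, hC⟩ := exists_abs_angularSnd_le hm n
  refine ⟨C, fun θ hθ => ?_⟩
  simpa [angularSnd_pi_sub, abs_mul] using hC _ (pi_sub_mem_Ioo hθ)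

end Modes

section BoundaryTerms

open MeasureTheory Set Filter Topology

variable {E : Type*} [NormedAddCommGroup E] {a b : ℝ}

theorem eq_zero_of_tendsto_of_integrableOn_sub_inv_smul [NormedSpace ℝ E] {F : ℝ → E} {c : ℝ}
    {L : E} (hab : a < b) (hc : c ∈ Icc a b) (hF : Tendsto F (𝓝[Ioo a b] c) (𝓝 L))
    (hint : IntegrableOn (fun x => (x - c)⁻¹ • F x) (Ioo a b)) : L = 0 := by
  classical
  by_contra hL
  -- Mathlib's non-integrability criterion is two-sided at `c`, so `F` is extended by its limit.
  set G : ℝ → E := (Ioo a b).piecewise F fun _ => L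
  have tendsto_G : Tendsto G (𝓝[≠] c) (𝓝 L) :=
    (hF.mono_left (nhdsWithin_mono c inter_subset_right)).piecewise_nhdsWithin tendsto_const_nhds
  have one_isBigO : (fun _ => (1 : ℝ)) =O[𝓝[≠] c] G :=
    (Asymptotics.isBigO_const_left_iff_pos_le_norm one_ne_zero).2
      ⟨‖L‖ / 2, half_pos (norm_pos_iff.2 hL),
        tendsto_G.norm.eventually_const_le (half_lt_self (norm_pos_iff.2 hL))⟩
  have inv_isBigO : (fun x => (x - c)⁻¹) =O[𝓝[≠] c] fun x => (x - c)⁻¹ • G x := by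
    simpa using (Asymptotics.isBigO_refl (fun x => (x - c)⁻¹) (𝓝[≠] c)).smul one_isBigO
  refine not_intervalIntegrable_of_sub_inv_isBigO_punctured inv_isBigO hab.ne
    (by rwa [uIcc_of_le hab.le]) ((intervalIntegrable_iff_integrableOn_Ioo_of_le hab.le).2 ?_)
  refine hint.congr_fun (fun x hx => ?_) measurableSet_Ioo
  simp only [G, piecewise_eq_of_mem _ _ _ hx]

theorem exists_continuousOn_Icc_eqOn_Ioo [NormedSpace ℝ E] [CompleteSpace E] {W W' : ℝ → E}
    (hab : a < b) (hderiv : ∀ x ∈ Ioo a b, HasDerivAt W (W' x) x)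
    (hint : IntegrableOn W' (Ioo a b)) :
    ∃ V, ContinuousOn V (Icc a b) ∧ EqOn V W (Ioo a b) := by
  obtain ⟨c, hc⟩ := nonempty_Ioo.2 hab
  have hc' : c ∈ uIcc a b := by simpa only [uIcc_of_le hab.le] using Ioo_subset_Icc_self hc
  have hint' := (intervalIntegrable_iff_integrableOn_Ioo_of_le hab.le).2 hint
  refine ⟨fun x => W c + ∫ y in c..x, W' y, ?_, fun x hx => ?_⟩
  · rw [← uIcc_of_le hab.le]
    exact continuousOn_const.add (intervalIntegral.continuousOn_primitive_interval' hint' hc')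
  · have hsub : uIcc c x ⊆ Ioo a b := ordConnected_Ioo.uIcc_subset hc hx
    have hcx : IntervalIntegrable W' volume c x :=
      (intervalIntegrable_iff.2 (hint.mono_set (uIoc_subset_uIcc.trans hsub)))
    simp only [intervalIntegral.integral_eq_sub_of_hasDerivAt (fun y hy => hderiv y (hsub hy)) hcx,
      add_sub_cancel]

theorem eq_zero_of_tendsto_of_norm_sq_le_abs_sub_mul {W : ℝ → E} {K : ℝ → ℝ} {c : ℝ} {L : E}
    (hab : a < b) (hc : c ∈ Icc a b) (hW : AEStronglyMeasurable W (volume.restrict (Ioo a b)))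
    (hK : IntegrableOn K (Ioo a b)) (hbound : ∀ x ∈ Ioo a b, ‖W x‖ ^ 2 ≤ |x - c| * K x)
    (hlim : Tendsto W (𝓝[Ioo a b] c) (𝓝 L)) : L = 0 := by
  have hint : IntegrableOn (fun x => (x - c)⁻¹ • ‖W x‖ ^ 2) (Ioo a b) := by
    have inv_aesm : AEStronglyMeasurable (fun x : ℝ => (x - c)⁻¹) (volume.restrict (Ioo a b)) :=
      (measurable_id.sub_const c).inv.aestronglyMeasurable
    refine Integrable.mono' hK.norm (inv_aesm.smul (hW.norm.pow 2)) ?_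
    filter_upwards [ae_restrict_mem measurableSet_Ioo] with x hx
    rw [norm_smul, norm_inv, norm_pow, norm_norm, Real.norm_eq_abs]
    exact inv_mul_le_of_le_mul₀ (abs_nonneg _) (norm_nonneg _)
      ((hbound x hx).trans (mul_le_mul_of_nonneg_left (le_abs_self _) (abs_nonneg _)))
  exact norm_eq_zero.1 <| (pow_eq_zero_iff two_ne_zero).1 <|
    eq_zero_of_tendsto_of_integrableOn_sub_inv_smul hab hc (hlim.norm.pow 2) hint

theorem integral_eq_zero_of_hasDerivAt_of_norm_sq_le [NormedSpace ℝ E] [CompleteSpace E]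
    {W W' : ℝ → E} {K : ℝ → ℝ} (hab : a < b) (hderiv : ∀ x ∈ Ioo a b, HasDerivAt W (W' x) x)
    (hint : IntegrableOn W' (Ioo a b)) (hK : IntegrableOn K (Ioo a b))
    (hleft : ∀ x ∈ Ioo a b, ‖W x‖ ^ 2 ≤ |x - a| * K x)
    (hright : ∀ x ∈ Ioo a b, ‖W x‖ ^ 2 ≤ |x - b| * K x) :
    ∫ x in Ioo a b, W' x = 0 := by
  obtain ⟨V, hV, hVW⟩ := exists_continuousOn_Icc_eqOn_Ioo hab hderiv hint
  have hW : AEStronglyMeasurable W (volume.restrict (Ioo a b)) :=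
    ContinuousOn.aestronglyMeasurable
      (fun x hx => (hderiv x hx).continuousAt.continuousWithinAt) measurableSet_Ioo
  have tendsto_W {c : ℝ} (hc : c ∈ Icc a b) : Tendsto W (𝓝[Ioo a b] c) (𝓝 (V c)) :=
    ((hV c hc).mono Ioo_subset_Icc_self).congr' (hVW.eventuallyEq_of_mem self_mem_nhdsWithin)
  have hVa : V a = 0 := eq_zero_of_tendsto_of_norm_sq_le_abs_sub_mul hab (left_mem_Icc.2 hab.le)
    hW hK hleft (tendsto_W (left_mem_Icc.2 hab.le))
  have hVb : V b = 0 := eq_zero_of_tendsto_of_norm_sq_le_abs_sub_mul hab (right_mem_Icc.2 hab.le)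
    hW hK hright (tendsto_W (right_mem_Icc.2 hab.le))
  have hV_deriv : ∀ x ∈ Ioo a b, HasDerivAt V (W' x) x := fun x hx =>
    (hderiv x hx).congr_of_eventuallyEq (hVW.eventuallyEq_of_mem (isOpen_Ioo.mem_nhds hx))
  rw [← integral_Ioc_eq_integral_Ioo, ← intervalIntegral.integral_of_le hab.le,
    intervalIntegral.integral_eq_sub_of_hasDerivAt_of_le hab.le hV hV_deriv
      ((intervalIntegrable_iff_integrableOn_Ioo_of_le hab.le).2 hint), hVa, hVb, sub_zero]

end BoundaryTerms

section ReducedSystem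

open MeasureTheory Set

variable {m : ℝ} {z w : ℂ} {ψ φ χ : ℝ → Fin 2 → ℂ}

/-- The coefficient matrix of the system `ψ' = M ψ` that `ψ = √(sin θ) S` satisfies when `S` is an
eigenfunction of the angular operator with `a = 0` and eigenvalue `z`. -/
noncomputable def reducedMatrix (m : ℝ) (z : ℂ) (θ : ℝ) : Matrix (Fin 2) (Fin 2) ℂ :=
  !![-((m / Real.sin θ : ℝ) : ℂ), -z; z, ((m / Real.sin θ : ℝ) : ℂ)]

theorem reducedMatrix_mulVec (m : ℝ) (z : ℂ) (θ : ℝ) (v : Fin 2 → ℂ) :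
    reducedMatrix m z θ *ᵥ v =
      ![-((m / Real.sin θ : ℝ) : ℂ) * v 0 - z * v 1,
        z * v 0 + ((m / Real.sin θ : ℝ) : ℂ) * v 1] := by
  funext i
  fin_cases i <;> simp [reducedMatrix, Matrix.mulVec, dotProduct, Fin.sum_univ_two, sub_eq_add_neg]

/-- `ψ` is a square integrable solution on `(0, π)` of the reduced system `ψ' = M ψ` with spectral
parameter `z`; the zero solution is allowed. -/
structure IsReducedSolution (m : ℝ) (z : ℂ) (ψ : ℝ → Fin 2 → ℂ) : Prop where
  hasDerivAt : ∀ θ ∈ Ioo 0 Real.pi, HasDerivAt ψ (reducedMatrix m z θ *ᵥ ψ θ) θ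
  memLp : MemLp ψ 2 (volume.restrict (Ioo 0 Real.pi))

namespace IsReducedSolution

theorem hasDerivAt_zero (h : IsReducedSolution m z ψ) {θ : ℝ} (hθ : θ ∈ Ioo 0 Real.pi) :
    HasDerivAt (ψ · 0) (-((m / Real.sin θ : ℝ) : ℂ) * ψ θ 0 - z * ψ θ 1) θ :=
  (hasDerivAt_pi.1 (h.hasDerivAt θ hθ) 0).congr_deriv (by rw [reducedMatrix_mulVec]; rfl)

theorem hasDerivAt_one (h : IsReducedSolution m z ψ) {θ : ℝ} (hθ : θ ∈ Ioo 0 Real.pi) :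
    HasDerivAt (ψ · 1) (z * ψ θ 0 + ((m / Real.sin θ : ℝ) : ℂ) * ψ θ 1) θ :=
  (hasDerivAt_pi.1 (h.hasDerivAt θ hθ) 1).congr_deriv (by rw [reducedMatrix_mulVec]; rfl)

theorem continuousOn (h : IsReducedSolution m z ψ) : ContinuousOn ψ (Ioo 0 Real.pi) :=
  fun θ hθ => (h.hasDerivAt θ hθ).continuousAt.continuousWithinAt

theorem sub (hψ : IsReducedSolution m z ψ) (hφ : IsReducedSolution m z φ) :
    IsReducedSolution m z (ψ - φ) where
  hasDerivAt θ hθ := by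
    simpa only [Pi.sub_apply, Matrix.mulVec_sub] using
      (hψ.hasDerivAt θ hθ).sub (hφ.hasDerivAt θ hθ)
  memLp := hψ.memLp.sub hφ.memLp

theorem const_smul (h : IsReducedSolution m z ψ) (c : ℂ) : IsReducedSolution m z (c • ψ) where
  hasDerivAt θ hθ := by
    simpa only [Pi.smul_apply, Matrix.mulVec_smul] using (h.hasDerivAt θ hθ).const_smul c
  memLp := h.memLp.const_smul c

theorem congr (h : IsReducedSolution m z ψ) (hφψ : EqOn φ ψ (Ioo 0 Real.pi)) :
    IsReducedSolution m z φ where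
  hasDerivAt θ hθ := by
    rw [hφψ hθ]
    exact (h.hasDerivAt θ hθ).congr_of_eventuallyEq
      (hφψ.eventuallyEq_of_mem (isOpen_Ioo.mem_nhds hθ))
  memLp := h.memLp.ae_eq (hφψ.symm.aeEq_restrict measurableSet_Ioo)

theorem swap (h : IsReducedSolution m z ψ) :
    IsReducedSolution (-m) (-z) fun θ => ![ψ θ 1, ψ θ 0] where
  hasDerivAt θ hθ := by
    rw [hasDerivAt_pi, Fin.forall_fin_two, reducedMatrix_mulVec]
    refine ⟨(h.hasDerivAt_one hθ).congr_deriv ?_, (h.hasDerivAt_zero hθ).congr_deriv ?_⟩ <;>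
    · simp [neg_div]
      ring
  memLp := memLp_pi_iff.2 <| Fin.forall_fin_two.2
    ⟨memLp_pi_iff.1 h.memLp 1, memLp_pi_iff.1 h.memLp 0⟩

end IsReducedSolution

/-- The bilinear pairing of two spinors on `(0, π)`. No complex conjugation is involved, which is
what makes reduced solutions with distinct parameters `z` orthogonal even for non-real `z`. -/
noncomputable def spinorPairing (ψ φ : ℝ → Fin 2 → ℂ) : ℂ :=
  ∫ θ in Ioo 0 Real.pi, ψ θ ⬝ᵥ φ θ

theorem integrable_dotProduct {Ω ι 𝕜 : Type*} [Fintype ι] [RCLike 𝕜] {_ : MeasurableSpace Ω}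
    {ν : Measure Ω} {f g : Ω → ι → 𝕜} (hf : MemLp f 2 ν) (hg : MemLp g 2 ν) :
    Integrable (fun x => f x ⬝ᵥ g x) ν :=
  integrable_finsetSum _ fun i _ => (memLp_pi_iff.1 hf i).integrable_mul (memLp_pi_iff.1 hg i)

theorem spinorPairing_sub_smul (hψ : MemLp ψ 2 (volume.restrict (Ioo 0 Real.pi)))
    (hφ : MemLp φ 2 (volume.restrict (Ioo 0 Real.pi)))
    (hχ : MemLp χ 2 (volume.restrict (Ioo 0 Real.pi))) (c : ℂ) :
    spinorPairing (ψ - c • φ) χ = spinorPairing ψ χ - c * spinorPairing φ χ := by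
  simp only [spinorPairing, Pi.sub_apply, Pi.smul_apply, sub_dotProduct, smul_dotProduct]
  rw [integral_sub (integrable_dotProduct hψ hχ) ((integrable_dotProduct hφ hχ).fun_smul c),
    integral_smul, smul_eq_mul]

theorem norm_mul_sub_mul_sq_le (v w : Fin 2 → ℂ) :
    ‖v 0 * w 1 - v 1 * w 0‖ ^ 2 ≤ 4 * (‖v‖ ^ 2 * ‖w‖ ^ 2) := by
  have norm_le : ‖v 0 * w 1 - v 1 * w 0‖ ≤ 2 * (‖v‖ * ‖w‖) := by
    refine (norm_sub_le _ _).trans ?_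
    rw [norm_mul, norm_mul, two_mul]
    gcongr <;> exact norm_le_pi_norm _ _
  calc ‖v 0 * w 1 - v 1 * w 0‖ ^ 2 ≤ (2 * (‖v‖ * ‖w‖)) ^ 2 :=
        pow_le_pow_left₀ (norm_nonneg _) norm_le 2
    _ = 4 * (‖v‖ ^ 2 * ‖w‖ ^ 2) := by ring

theorem sin_le_abs_sub {θ c : ℝ} (hθ : θ ∈ Ioo 0 Real.pi) (hc : Real.sin c = 0) :
    Real.sin θ ≤ |θ - c| := by
  simpa only [hc, sub_zero, abs_of_pos (Real.sin_pos_of_mem_Ioo hθ)] using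
    Real.abs_sin_sub_sin_le θ c

theorem IsReducedSolution.spinorPairing_eq_zero (hψ : IsReducedSolution m z ψ)
    (hφ : IsReducedSolution m w φ) (hzw : z ≠ w) {C : ℝ}
    (hC : ∀ θ ∈ Ioo 0 Real.pi, ‖φ θ‖ ≤ C * √(Real.sin θ)) : spinorPairing ψ φ = 0 := by
  have wronskian_deriv : ∀ θ ∈ Ioo 0 Real.pi,
      HasDerivAt (fun θ => ψ θ 0 * φ θ 1 - ψ θ 1 * φ θ 0) ((w - z) * (ψ θ ⬝ᵥ φ θ)) θ := by
    intro θ hθ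
    refine (((hψ.hasDerivAt_zero hθ).fun_mul (hφ.hasDerivAt_one hθ)).fun_sub
      ((hψ.hasDerivAt_one hθ).fun_mul (hφ.hasDerivAt_zero hθ))).congr_deriv ?_
    rw [dotProduct, Fin.sum_univ_two]
    ring
  have wronskian_bound {c : ℝ} (hc : Real.sin c = 0) : ∀ θ ∈ Ioo 0 Real.pi,
      ‖ψ θ 0 * φ θ 1 - ψ θ 1 * φ θ 0‖ ^ 2 ≤ |θ - c| * (4 * C ^ 2 * ‖ψ θ‖ ^ 2) := by
    intro θ hθ
    have norm_sq_le : ‖φ θ‖ ^ 2 ≤ |θ - c| * C ^ 2 := calc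
      ‖φ θ‖ ^ 2 ≤ (C * √(Real.sin θ)) ^ 2 := pow_le_pow_left₀ (norm_nonneg _) (hC θ hθ) 2
      _ = Real.sin θ * C ^ 2 := by
        rw [mul_pow, Real.sq_sqrt (Real.sin_pos_of_mem_Ioo hθ).le, mul_comm]
      _ ≤ |θ - c| * C ^ 2 := mul_le_mul_of_nonneg_right (sin_le_abs_sub hθ hc) (sq_nonneg C)
    calc _ ≤ 4 * (‖ψ θ‖ ^ 2 * ‖φ θ‖ ^ 2) := norm_mul_sub_mul_sq_le _ _
      _ ≤ 4 * (‖ψ θ‖ ^ 2 * (|θ - c| * C ^ 2)) := by gcongr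
      _ = |θ - c| * (4 * C ^ 2 * ‖ψ θ‖ ^ 2) := by ring
  have integral_eq_zero := integral_eq_zero_of_hasDerivAt_of_norm_sq_le Real.pi_pos wronskian_deriv
    ((integrable_dotProduct hψ.memLp hφ.memLp).const_mul (w - z))
    ((hψ.memLp.integrable_norm_pow two_ne_zero).const_mul (4 * C ^ 2))
    (wronskian_bound Real.sin_zero) (wronskian_bound Real.sin_pi)
  rw [integral_const_mul] at integral_eq_zero
  exact (mul_eq_zero.1 integral_eq_zero).resolve_left (sub_ne_zero.2 hzw.symm)

end ReducedSystem

section Classification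

open MeasureTheory Set

variable {m ε : ℝ} {n : ℕ} {z : ℂ} {ψ : ℝ → Fin 2 → ℂ}

/-- The solution of the reduced system, with parameter `ε (n + 1/2 + m)`, that corresponds to the
eigenfunction of the angular operator with index `n` and sign `ε`. -/
noncomputable def angularMode (m : ℝ) (n : ℕ) (ε θ : ℝ) : Fin 2 → ℂ :=
  ![((ε * angularFst m n θ : ℝ) : ℂ), ((-angularSnd m n θ : ℝ) : ℂ)]

theorem exists_norm_angularMode_le (hm : 1 / 2 ≤ m) (n : ℕ) (ε : ℝ) :
    ∃ C : ℝ, ∀ θ ∈ Ioo 0 Real.pi, ‖angularMode m n ε θ‖ ≤ C * √(Real.sin θ) := by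
  obtain ⟨A, hA⟩ := exists_abs_angularFst_le hm n
  obtain ⟨B, hB⟩ := exists_abs_angularSnd_le hm n
  refine ⟨max (|ε| * A) B, fun θ hθ => ?_⟩
  have fst_le : ‖((ε * angularFst m n θ : ℝ) : ℂ)‖ ≤ |ε| * A * √(Real.sin θ) := by
    rw [Complex.norm_real, norm_mul, mul_assoc]
    exact mul_le_mul_of_nonneg_left (hA θ hθ) (abs_nonneg ε)
  have snd_le : ‖((-angularSnd m n θ : ℝ) : ℂ)‖ ≤ B * √(Real.sin θ) := by
    simpa only [Complex.norm_real, norm_neg, Real.norm_eq_abs] using hB θ hθ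
  have le_max_mul {D : ℝ} (hD : D ≤ max (|ε| * A) B) :
      D * √(Real.sin θ) ≤ max (|ε| * A) B * √(Real.sin θ) :=
    mul_le_mul_of_nonneg_right hD (Real.sqrt_nonneg _)
  refine (pi_norm_le_iff_of_nonneg (((norm_nonneg _).trans snd_le).trans
    (le_max_mul (le_max_right _ _)))).2 <| Fin.forall_fin_two.2
    ⟨fst_le.trans (le_max_mul (le_max_left _ _)), snd_le.trans (le_max_mul (le_max_right _ _))⟩

theorem hasDerivAt_angularMode (m : ℝ) (n : ℕ) (hε : ε = 1 ∨ ε = -1) {θ : ℝ}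
    (hθ : θ ∈ Ioo 0 Real.pi) :
    HasDerivAt (angularMode m n ε)
      (reducedMatrix m ((ε * (n + 1 / 2 + m) : ℝ) : ℂ) θ *ᵥ angularMode m n ε θ) θ := by
  have hε_sq : (ε : ℂ) * ε = 1 := by exact_mod_cast mul_self_eq_one_iff.2 hε
  rw [hasDerivAt_pi, Fin.forall_fin_two, reducedMatrix_mulVec]
  refine ⟨(((hasDerivAt_angularFst m n hθ).const_mul ε).ofReal_comp).congr_deriv ?_,
    (hasDerivAt_angularSnd m n hθ).fun_neg.ofReal_comp.congr_deriv ?_⟩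
  · simp only [angularMode, Matrix.cons_val_zero, Matrix.cons_val_one]
    push_cast
    ring
  · simp only [angularMode, Matrix.cons_val_zero, Matrix.cons_val_one]
    push_cast
    linear_combination -((n : ℂ) + 1 / 2 + m) * angularFst m n θ * hε_sq

theorem isReducedSolution_angularMode (hm : 1 / 2 ≤ m) (n : ℕ) (hε : ε = 1 ∨ ε = -1) :
    IsReducedSolution m ((ε * (n + 1 / 2 + m) : ℝ) : ℂ) (angularMode m n ε) where
  hasDerivAt _ hθ := hasDerivAt_angularMode m n hε hθ
  memLp := by
    obtain ⟨C, hC⟩ := exists_norm_angularMode_le hm n ε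
    have hcont : ContinuousOn (angularMode m n ε) (Ioo 0 Real.pi) := fun θ hθ =>
      (hasDerivAt_angularMode m n hε hθ).continuousAt.continuousWithinAt
    refine .of_bound (hcont.aestronglyMeasurable measurableSet_Ioo) |C| ?_
    filter_upwards [ae_restrict_mem measurableSet_Ioo] with θ hθ
    refine (hC θ hθ).trans ((mul_le_mul_of_nonneg_right (le_abs_self C) (Real.sqrt_nonneg _)).trans
      (mul_le_of_le_one_right (abs_nonneg C) ?_))
    exact Real.sqrt_le_one.2 (Real.sin_le_one θ)

theorem exists_mem_Ioo_angularMode_ne_zero (hm : 1 / 2 ≤ m) (n : ℕ) (ε : ℝ) :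
    ∃ θ ∈ Ioo 0 Real.pi, angularMode m n ε θ ≠ 0 := by
  obtain ⟨x, hx, hne⟩ := exists_mem_Ioo_jacobiP_ne_zero n (α := m - 1 / 2) (β := m + 1 / 2)
    (by linarith) (by linarith) (show (-1 : ℝ) < 1 by norm_num)
  have hθ : Real.arccos x ∈ Ioo 0 Real.pi :=
    ⟨Real.arccos_pos.2 hx.2, Real.arccos_lt_pi.2 hx.1⟩
  have snd_ne_zero : angularSnd m n (Real.arccos x) ≠ 0 := by
    rw [angularSnd, Real.cos_arccos hx.1.le hx.2.le]
    have hs := Real.sin_pos_of_mem_Ioo hθ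
    refine mul_ne_zero (mul_ne_zero (Real.rpow_pos_of_pos hs m).ne' ?_) hne
    exact (Real.sqrt_pos.2 (by linarith [hx.1])).ne'
  refine ⟨_, hθ, fun h => snd_ne_zero ?_⟩
  simpa [angularMode] using congrFun h 1

theorem eqOn_zero_of_forall_integral_mul_jacobiP_cos {E : Type*} [NormedAddCommGroup E]
    [NormedSpace ℝ E] [CompleteSpace E] {α β : ℝ} (hα : -1 < α) (hβ : -1 < β) {p : ℝ → ℝ}
    (hp : Continuous p) (hp_ne : ∀ θ ∈ Ioo 0 Real.pi, p θ ≠ 0) {f : ℝ → E}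
    (hf : IntegrableOn f (Ioo 0 Real.pi)) (hcont : ContinuousOn f (Ioo 0 Real.pi))
    (h : ∀ n, ∫ θ in Ioo 0 Real.pi, (p θ * jacobiP n α β (Real.cos θ)) • f θ = 0) :
    EqOn f 0 (Ioo 0 Real.pi) := by
  have weighted_eq_zero : EqOn (fun θ => p θ • f θ) 0 (Ioo 0 Real.pi) := by
    refine eqOn_zero_of_forall_integral_jacobiP_cos hα hβ ?_ (hp.continuousOn.smul hcont)
      fun n => ?_
    · exact hf.continuousOn_smul_of_subset hp.continuousOn isCompact_Icc measurableSet_Ioo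
        Ioo_subset_Icc_self
    · simpa only [smul_smul, mul_comm] using h n
  exact fun θ hθ => (smul_eq_zero.1 (weighted_eq_zero hθ)).resolve_left (hp_ne θ hθ)

theorem eqOn_zero_of_forall_integral_angularFst (hm : 1 / 2 ≤ m) {f : ℝ → ℂ}
    (hf : IntegrableOn f (Ioo 0 Real.pi)) (hcont : ContinuousOn f (Ioo 0 Real.pi))
    (h : ∀ n, ∫ θ in Ioo 0 Real.pi, angularFst m n θ • f θ = 0) : EqOn f 0 (Ioo 0 Real.pi) := by
  have hsin : Continuous fun θ => Real.sin θ ^ m :=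
    Real.continuous_sin.rpow_const fun _ => Or.inr (by linarith)
  refine eqOn_zero_of_forall_integral_mul_jacobiP_cos (by linarith) (by linarith)
    (p := fun θ => Real.sin θ ^ m * √(1 - Real.cos θ)) (by fun_prop) (fun θ hθ => ?_) hf hcont h
  exact mul_ne_zero (Real.rpow_pos_of_pos (Real.sin_pos_of_mem_Ioo hθ) m).ne'
    (Real.sqrt_pos.2 (sub_pos.2 (cos_mem_Ioo hθ).2)).ne'

theorem eqOn_zero_of_forall_integral_angularSnd (hm : 1 / 2 ≤ m) {f : ℝ → ℂ}
    (hf : IntegrableOn f (Ioo 0 Real.pi)) (hcont : ContinuousOn f (Ioo 0 Real.pi))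
    (h : ∀ n, ∫ θ in Ioo 0 Real.pi, angularSnd m n θ • f θ = 0) : EqOn f 0 (Ioo 0 Real.pi) := by
  have hsin : Continuous fun θ => Real.sin θ ^ m :=
    Real.continuous_sin.rpow_const fun _ => Or.inr (by linarith)
  refine eqOn_zero_of_forall_integral_mul_jacobiP_cos (by linarith) (by linarith)
    (p := fun θ => Real.sin θ ^ m * √(1 + Real.cos θ)) (by fun_prop) (fun θ hθ => ?_) hf hcont h
  exact mul_ne_zero (Real.rpow_pos_of_pos (Real.sin_pos_of_mem_Ioo hθ) m).ne'
    (Real.sqrt_pos.2 (neg_lt_iff_pos_add'.1 (cos_mem_Ioo hθ).1)).ne'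

theorem spinorPairing_angularMode (hm : 1 / 2 ≤ m) (n : ℕ) (hε : ε = 1 ∨ ε = -1)
    (hψ : MemLp ψ 2 (volume.restrict (Ioo 0 Real.pi))) :
    spinorPairing ψ (angularMode m n ε) =
      ε * (∫ θ in Ioo 0 Real.pi, angularFst m n θ • ψ θ 0) -
        ∫ θ in Ioo 0 Real.pi, angularSnd m n θ • ψ θ 1 := by
  have mode_memLp := memLp_pi_iff.1 (isReducedSolution_angularMode hm n hε).memLp
  have integrable (i : Fin 2) : Integrable (fun θ => ψ θ i * angularMode m n ε θ i)
      (volume.restrict (Ioo 0 Real.pi)) := (memLp_pi_iff.1 hψ i).integrable_mul (mode_memLp i)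
  simp only [spinorPairing, dotProduct, Fin.sum_univ_two]
  rw [integral_add (integrable 0) (integrable 1), sub_eq_add_neg, ← integral_const_mul,
    ← integral_neg]
  congr 2 <;> funext θ <;> simp [angularMode] <;> ring

theorem eqOn_zero_of_forall_spinorPairing_angularMode (hm : 1 / 2 ≤ m)
    (hψ : MemLp ψ 2 (volume.restrict (Ioo 0 Real.pi))) (hcont : ContinuousOn ψ (Ioo 0 Real.pi))
    (h : ∀ n ε, (ε = 1 ∨ ε = -1) → spinorPairing ψ (angularMode m n ε) = 0) :
    EqOn ψ 0 (Ioo 0 Real.pi) := by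
  have integrableOn (i : Fin 2) : IntegrableOn (ψ · i) (Ioo 0 Real.pi) :=
    (memLp_pi_iff.1 hψ i).integrable one_le_two
  have pairing_one (n : ℕ) :=
    (spinorPairing_angularMode hm n (Or.inl rfl) hψ).symm.trans (h n 1 (Or.inl rfl))
  have pairing_neg_one (n : ℕ) :=
    (spinorPairing_angularMode hm n (Or.inr rfl) hψ).symm.trans (h n (-1) (Or.inr rfl))
  push_cast at pairing_one pairing_neg_one
  have fst_eq_zero := eqOn_zero_of_forall_integral_angularFst hm (integrableOn 0)
    (continuousOn_pi.1 hcont 0) fun n => by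
      linear_combination (pairing_one n - pairing_neg_one n) / 2
  have snd_eq_zero := eqOn_zero_of_forall_integral_angularSnd hm (integrableOn 1)
    (continuousOn_pi.1 hcont 1) fun n => by
      linear_combination -(pairing_one n + pairing_neg_one n) / 2
  exact fun θ hθ => funext <| Fin.forall_fin_two.2 ⟨fst_eq_zero hθ, snd_eq_zero hθ⟩

theorem mul_eq_mul_iff_of_sign {ε δ x y : ℝ} (hε : ε = 1 ∨ ε = -1) (hδ : δ = 1 ∨ δ = -1)
    (hx : 0 < x) (hy : 0 < y) : ε * x = δ * y ↔ ε = δ ∧ x = y := by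
  rcases hε with rfl | rfl <;> rcases hδ with rfl | rfl <;> constructor <;> intro h <;>
    first | (constructor <;> linarith) | linarith [h.1, h.2]

theorem IsReducedSolution.eqOn_zero_of_spinorPairing_eq_zero (hm : 1 / 2 ≤ m)
    (hε : ε = 1 ∨ ε = -1) (hψ : IsReducedSolution m ((ε * (n + 1 / 2 + m) : ℝ) : ℂ) ψ)
    (h : spinorPairing ψ (angularMode m n ε) = 0) : EqOn ψ 0 (Ioo 0 Real.pi) := by
  refine eqOn_zero_of_forall_spinorPairing_angularMode hm hψ.memLp hψ.continuousOn
    fun k δ hδ => ?_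
  by_cases heq : ε * (n + 1 / 2 + m) = δ * (k + 1 / 2 + m)
  · obtain ⟨rfl, hnk⟩ := (mul_eq_mul_iff_of_sign hε hδ (by positivity) (by positivity)).1 heq
    obtain rfl : n = k := by exact_mod_cast add_right_cancel (add_right_cancel hnk)
    exact h
  · obtain ⟨C, hC⟩ := exists_norm_angularMode_le hm k δ
    exact hψ.spinorPairing_eq_zero (isReducedSolution_angularMode hm k hδ)
      (mod_cast heq) hC

theorem IsReducedSolution.exists_eqOn_smul_angularMode (hm : 1 / 2 ≤ m) (hε : ε = 1 ∨ ε = -1)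
    (hψ : IsReducedSolution m ((ε * (n + 1 / 2 + m) : ℝ) : ℂ) ψ) :
    ∃ c : ℂ, EqOn ψ (c • angularMode m n ε) (Ioo 0 Real.pi) := by
  have hmode := isReducedSolution_angularMode hm n hε
  have pairing_self_ne_zero : spinorPairing (angularMode m n ε) (angularMode m n ε) ≠ 0 := by
    intro h
    obtain ⟨θ, hθ, hne⟩ := exists_mem_Ioo_angularMode_ne_zero hm n ε
    exact hne (hmode.eqOn_zero_of_spinorPairing_eq_zero hm hε h hθ)
  set c := spinorPairing ψ (angularMode m n ε) / spinorPairing (angularMode m n ε)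
    (angularMode m n ε)
  have pairing_sub_eq_zero : spinorPairing (ψ - c • angularMode m n ε) (angularMode m n ε) = 0 := by
    rw [spinorPairing_sub_smul hψ.memLp hmode.memLp hmode.memLp,
      div_mul_cancel₀ _ pairing_self_ne_zero, sub_self]
  exact ⟨c, fun θ hθ => sub_eq_zero.1 <|
    (hψ.sub (hmode.const_smul c)).eqOn_zero_of_spinorPairing_eq_zero hm hε pairing_sub_eq_zero hθ⟩

theorem IsReducedSolution.exists_eq_of_ne_zero (hm : 1 / 2 ≤ m) (hψ : IsReducedSolution m z ψ)
    (hne : ∃ θ ∈ Ioo 0 Real.pi, ψ θ ≠ 0) :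
    ∃ (n : ℕ) (ε : ℝ), (ε = 1 ∨ ε = -1) ∧ z = ((ε * (n + 1 / 2 + m) : ℝ) : ℂ) := by
  by_contra! hz
  obtain ⟨θ, hθ, hψθ⟩ := hne
  refine hψθ (eqOn_zero_of_forall_spinorPairing_angularMode hm hψ.memLp hψ.continuousOn
    (fun n ε hε => ?_) hθ)
  obtain ⟨C, hC⟩ := exists_norm_angularMode_le hm n ε
  exact hψ.spinorPairing_eq_zero (isReducedSolution_angularMode hm n hε) (hz n ε hε) hC

/-- On `(0, π)`, `ψ` is a nonzero multiple of one of the modes with parameter `z`. The condition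
`0 ≤ n + 2m` excludes the indices for which the formulas for the modes, which still make sense for
negative half-integers `m`, give zero or a function that is not square integrable. -/
def IsModeMultiple (m : ℝ) (z : ℂ) (ψ : ℝ → Fin 2 → ℂ) : Prop :=
  ∃ n : ℕ, 0 ≤ n + 2 * m ∧ ∃ ε : ℝ, (ε = 1 ∨ ε = -1) ∧ z = ((ε * (n + 1 / 2 + m) : ℝ) : ℂ) ∧
    ∃ c : ℂ, c ≠ 0 ∧ EqOn ψ (c • angularMode m n ε) (Ioo 0 Real.pi)

theorem isReducedSolution_and_ne_zero_iff_of_half_le (hm : 1 / 2 ≤ m) :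
    (IsReducedSolution m z ψ ∧ ∃ θ ∈ Ioo 0 Real.pi, ψ θ ≠ 0) ↔ IsModeMultiple m z ψ := by
  constructor
  · rintro ⟨hψ, hne⟩
    obtain ⟨n, ε, hε, rfl⟩ := hψ.exists_eq_of_ne_zero hm hne
    obtain ⟨c, hc⟩ := hψ.exists_eqOn_smul_angularMode hm hε
    refine ⟨n, by positivity, ε, hε, rfl, c, ?_, hc⟩
    rintro rfl
    obtain ⟨θ, hθ, hψθ⟩ := hne
    exact hψθ (by simpa using hc hθ)
  · rintro ⟨n, -, ε, hε, rfl, c, hc, hψ⟩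
    refine ⟨((isReducedSolution_angularMode hm n hε).const_smul c).congr hψ, ?_⟩
    obtain ⟨θ, hθ, hne⟩ := exists_mem_Ioo_angularMode_ne_zero hm n ε
    exact ⟨θ, hθ, (hψ hθ).symm ▸ smul_ne_zero hc hne⟩

theorem isReducedSolution_swap_iff :
    IsReducedSolution (-m) (-z) (fun θ => ![ψ θ 1, ψ θ 0]) ↔ IsReducedSolution m z ψ := by
  refine ⟨fun h => ?_, fun h => h.swap⟩
  have swap_swap := h.swap
  rw [neg_neg, neg_neg] at swap_swap
  exact swap_swap.congr fun θ _ => funext <| Fin.forall_fin_two.2 ⟨rfl, rfl⟩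

theorem angularMode_neg (n k : ℕ) (hε : ε = 1 ∨ ε = -1) {θ : ℝ} (hθ : θ ∈ Ioo 0 Real.pi) :
    ![angularMode (-((k : ℝ) + 1 / 2)) (n + (2 * k + 1)) ε θ 1,
      angularMode (-((k : ℝ) + 1 / 2)) (n + (2 * k + 1)) ε θ 0] =
      (((-1) ^ (k + 1) * (1 / 2) ^ (2 * k + 1) * ε : ℝ) : ℂ) •
        angularMode (k + 1 / 2) n (-ε) θ := by
  have hε_sq : (ε : ℂ) * ε = 1 := by exact_mod_cast mul_self_eq_one_iff.2 hε
  refine funext <| Fin.forall_fin_two.2 ⟨?_, ?_⟩ <;>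
    simp only [angularMode, Matrix.cons_val_zero, Matrix.cons_val_one, Pi.smul_apply, smul_eq_mul,
      angularSnd_neg n k hθ, angularFst_neg n k hθ] <;> push_cast
  · linear_combination
      (-1) ^ (k + 1) * (1 / 2) ^ (2 * k + 1) * (angularFst (k + 1 / 2) n θ : ℂ) * hε_sq
  · ring

theorem vecCons_swap_inj {α : Type*} {v w : Fin 2 → α} : ![v 1, v 0] = ![w 1, w 0] ↔ v = w := by
  simp only [funext_iff, Fin.forall_fin_two, Matrix.cons_val_zero, Matrix.cons_val_one, and_comm]

theorem eqOn_smul_angularMode_neg_iff (n k : ℕ) (hε : ε = 1 ∨ ε = -1) (c : ℂ) :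
    EqOn ψ (c • angularMode (-((k : ℝ) + 1 / 2)) (n + (2 * k + 1)) ε) (Ioo 0 Real.pi) ↔
      EqOn (fun θ => ![ψ θ 1, ψ θ 0])
        ((c * (((-1) ^ (k + 1) * (1 / 2) ^ (2 * k + 1) * ε : ℝ) : ℂ)) •
          angularMode (k + 1 / 2) n (-ε)) (Ioo 0 Real.pi) := by
  refine forall₂_congr fun θ hθ => ?_
  rw [Pi.smul_apply, Pi.smul_apply, mul_smul, ← angularMode_neg n k hε hθ, Matrix.smul_cons,
    Matrix.smul_cons, Matrix.smul_empty, ← vecCons_swap_inj]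
  rfl

theorem isModeMultiple_swap_iff (k : ℕ) :
    IsModeMultiple (k + 1 / 2) (-z) (fun θ => ![ψ θ 1, ψ θ 0]) ↔
      IsModeMultiple (-((k : ℝ) + 1 / 2)) z ψ := by
  have scale_ne_zero {ε : ℝ} (hε : ε = 1 ∨ ε = -1) :
      (((-1) ^ (k + 1) * (1 / 2) ^ (2 * k + 1) * ε : ℝ) : ℂ) ≠ 0 :=
    Complex.ofReal_ne_zero.2 (by rcases hε with rfl | rfl <;> simp)
  constructor
  · rintro ⟨n, -, ε, hε, hz, c, hc, hψ⟩
    have hε' : -ε = 1 ∨ -ε = -1 := by simpa [neg_eq_iff_eq_neg, or_comm] using hε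
    refine ⟨n + (2 * k + 1), ?_, -ε, hε', ?_, c / _, div_ne_zero hc (scale_ne_zero hε'), ?_⟩
    · push_cast; linarith [Nat.cast_nonneg (α := ℝ) n]
    · rw [neg_eq_iff_eq_neg.1 hz]; push_cast; ring
    · rwa [eqOn_smul_angularMode_neg_iff n k hε', div_mul_cancel₀ _ (scale_ne_zero hε'), neg_neg]
  · rintro ⟨N, hN, ε, hε, rfl, c, hc, hψ⟩
    have hkN : 2 * k + 1 ≤ N := by
      have : ((2 * k + 1 : ℕ) : ℝ) ≤ N := by push_cast; linarith
      exact_mod_cast this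
    obtain ⟨n, rfl⟩ := Nat.exists_eq_add_of_le' hkN
    refine ⟨n, by positivity, -ε, by simpa [neg_eq_iff_eq_neg, or_comm] using hε, ?_, _,
      mul_ne_zero hc (scale_ne_zero hε), (eqOn_smul_angularMode_neg_iff n k hε c).1 hψ⟩
    push_cast; ring

theorem half_le_or_exists_eq_neg (hm : 1 / 2 ≤ m ∨ ∃ k : ℤ, m = k + 1 / 2) :
    1 / 2 ≤ m ∨ ∃ k : ℕ, m = -((k : ℝ) + 1 / 2) := by
  rcases hm with hm | ⟨k, rfl⟩
  · exact Or.inl hm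
  · rcases k with k | k
    · exact Or.inl (by simp)
    · exact Or.inr ⟨k, by push_cast; ring⟩

theorem isReducedSolution_and_ne_zero_iff (hm : 1 / 2 ≤ m ∨ ∃ k : ℤ, m = k + 1 / 2) :
    (IsReducedSolution m z ψ ∧ ∃ θ ∈ Ioo 0 Real.pi, ψ θ ≠ 0) ↔ IsModeMultiple m z ψ := by
  rcases half_le_or_exists_eq_neg hm with hm | ⟨k, rfl⟩
  · exact isReducedSolution_and_ne_zero_iff_of_half_le hm
  · have swap_ne_zero (θ : ℝ) : ![ψ θ 1, ψ θ 0] ≠ 0 ↔ ψ θ ≠ 0 := by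
      simp [funext_iff, Fin.forall_fin_two, and_comm]
    rw [← isReducedSolution_swap_iff, neg_neg, ← isModeMultiple_swap_iff,
      ← isReducedSolution_and_ne_zero_iff_of_half_le (by simp)]
    simp only [swap_ne_zero]

theorem index_add_half_add_pos (hn : 0 ≤ n + 2 * m) : 0 < n + 1 / 2 + m := by
  linarith [Nat.cast_nonneg (α := ℝ) n]

end Classification

section AngularEquation

open MeasureTheory Set

variable {ω μ m ε : ℝ} {n : ℕ} {z : ℂ} {S : ℝ → Fin 2 → ℂ}

theorem memLp_angularMeasure_iff {E : Type*} [NormedAddCommGroup E] [NormedSpace ℝ E] {F : ℝ → E}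
    (hF : ContinuousOn F (Ioo 0 Real.pi)) :
    MemLp F 2 angularMeasure ↔
      MemLp (fun θ => √(Real.sin θ) • F θ) 2 (volume.restrict (Ioo 0 Real.pi)) := by
  have sqrt_sin_cont : Continuous fun θ => √(Real.sin θ) := by fun_prop
  have hF_meas : AEStronglyMeasurable F (volume.restrict (Ioo 0 Real.pi)) :=
    hF.aestronglyMeasurable measurableSet_Ioo
  rw [angularMeasure,
    memLp_two_iff_integrable_sq_norm (hF_meas.mono_ac (withDensity_absolutelyContinuous _ _)),
    memLp_two_iff_integrable_sq_norm (sqrt_sin_cont.aestronglyMeasurable.fun_smul hF_meas),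
    integrable_withDensity_iff_integrable_smul' (by fun_prop)
      (Filter.Eventually.of_forall fun _ => ENNReal.ofReal_lt_top),
    ← integrable_const_mul_iff (isUnit_iff_ne_zero.2 (two_ne_zero (α := ℝ)))
      fun θ => ‖√(Real.sin θ) • F θ‖ ^ 2]
  refine integrable_congr ?_
  filter_upwards [ae_restrict_mem measurableSet_Ioo] with θ hθ
  have sin_nonneg := (Real.sin_pos_of_mem_Ioo hθ).le
  rw [ENNReal.toReal_ofReal (by positivity), norm_smul, mul_pow, Real.norm_eq_abs, sq_abs,
    Real.sq_sqrt sin_nonneg, smul_eq_mul, mul_assoc]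

theorem angularOperator_zero_eq_smul_iff {θ : ℝ} (hθ : θ ∈ Ioo 0 Real.pi) :
    angularOperator 0 ω μ m S θ = z • S θ ↔
      deriv S θ + (Real.cos θ / (2 * Real.sin θ)) • S θ = reducedMatrix m z θ *ᵥ S θ := by
  have sin_ne_zero : (Real.sin θ : ℂ) ≠ 0 :=
    Complex.ofReal_ne_zero.2 (Real.sin_pos_of_mem_Ioo hθ).ne'
  rw [reducedMatrix_mulVec, funext_iff, funext_iff, Fin.forall_fin_two, Fin.forall_fin_two,
    and_comm]
  simp only [angularOperator, Matrix.mulVec, dotProduct, Fin.sum_univ_two, Pi.smul_apply,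
    Pi.add_apply, smul_eq_mul, Complex.real_smul, Matrix.of_apply, Matrix.cons_val',
    Matrix.cons_val_zero, Matrix.cons_val_one, Matrix.cons_val_fin_one, zero_mul,
    Complex.ofReal_zero, mul_zero]
  push_cast at sin_ne_zero ⊢
  constructor <;>
  · rintro ⟨h₀, h₁⟩
    field_simp at h₀ h₁ ⊢
    exact ⟨by linear_combination -h₀, by linear_combination h₁⟩

theorem hasDerivAt_sqrt_sin {θ : ℝ} (hθ : θ ∈ Ioo 0 Real.pi) :
    HasDerivAt (fun θ => √(Real.sin θ))
      (√(Real.sin θ) * (Real.cos θ / (2 * Real.sin θ))) θ := by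
  have sin_pos := Real.sin_pos_of_mem_Ioo hθ
  have sqrt_ne_zero := (Real.sqrt_pos.2 sin_pos).ne'
  refine ((Real.hasDerivAt_sin θ).sqrt sin_pos.ne').congr_deriv ?_
  nth_rw 3 [← Real.mul_self_sqrt sin_pos.le]
  field_simp [sqrt_ne_zero]

theorem differentiableAt_sqrt_sin_smul_iff {E : Type*} [NormedAddCommGroup E] [NormedSpace ℝ E]
    {F : ℝ → E} {θ : ℝ} (hθ : θ ∈ Ioo 0 Real.pi) :
    DifferentiableAt ℝ (fun θ => √(Real.sin θ) • F θ) θ ↔ DifferentiableAt ℝ F θ := by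
  have differentiableAt_sqrt := (hasDerivAt_sqrt_sin hθ).differentiableAt
  refine ⟨fun h => ?_, differentiableAt_sqrt.fun_smul⟩
  refine ((differentiableAt_sqrt.fun_inv
    (Real.sqrt_pos.2 (Real.sin_pos_of_mem_Ioo hθ)).ne').fun_smul h).congr_of_eventuallyEq ?_
  filter_upwards [isOpen_Ioo.mem_nhds hθ] with x hx
  rw [inv_smul_smul₀ (Real.sqrt_pos.2 (Real.sin_pos_of_mem_Ioo hx)).ne']

theorem hasDerivAt_sqrt_sin_smul_iff {θ : ℝ} (hθ : θ ∈ Ioo 0 Real.pi) :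
    HasDerivAt (fun θ => √(Real.sin θ) • S θ)
        (reducedMatrix m z θ *ᵥ (√(Real.sin θ) • S θ)) θ ↔
      DifferentiableAt ℝ S θ ∧ angularOperator 0 ω μ m S θ = z • S θ := by
  have sqrt_ne_zero := (Real.sqrt_pos.2 (Real.sin_pos_of_mem_Ioo hθ)).ne'
  have deriv_eq (hS : DifferentiableAt ℝ S θ) :
      HasDerivAt (fun θ => √(Real.sin θ) • S θ)
        (√(Real.sin θ) • (deriv S θ + (Real.cos θ / (2 * Real.sin θ)) • S θ)) θ :=
    ((hasDerivAt_sqrt_sin hθ).fun_smul hS.hasDerivAt).congr_deriv (by rw [smul_add, mul_smul])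
  rw [angularOperator_zero_eq_smul_iff hθ, Matrix.mulVec_smul]
  constructor
  · intro h
    have hS := (differentiableAt_sqrt_sin_smul_iff hθ).1 h.differentiableAt
    exact ⟨hS, smul_right_injective _ sqrt_ne_zero ((deriv_eq hS).unique h)⟩
  · rintro ⟨hS, heq⟩
    exact heq ▸ deriv_eq hS

theorem isAngularEigenfunction_zero_iff_isReducedSolution :
    IsAngularEigenfunction 0 ω μ m z S ↔
      IsReducedSolution m z (fun θ => √(Real.sin θ) • S θ) ∧
        ∃ θ ∈ Ioo 0 Real.pi, √(Real.sin θ) • S θ ≠ 0 := by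
  have nonzero_iff : (∃ θ ∈ Ioo 0 Real.pi, √(Real.sin θ) • S θ ≠ 0) ↔
      ∃ θ ∈ Ioo 0 Real.pi, S θ ≠ 0 :=
    exists_congr fun θ => and_congr_right fun hθ =>
      smul_ne_zero_iff_right (Real.sqrt_pos.2 (Real.sin_pos_of_mem_Ioo hθ)).ne'
  have memLp_iff (hS : DifferentiableOn ℝ S (Ioo 0 Real.pi)) :=
    memLp_angularMeasure_iff hS.continuousOn
  rw [nonzero_iff]
  constructor
  · intro h
    exact ⟨⟨fun θ hθ => (hasDerivAt_sqrt_sin_smul_iff hθ).2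
      ⟨h.differentiableOn.differentiableAt (isOpen_Ioo.mem_nhds hθ), h.eigen θ hθ⟩,
      (memLp_iff h.differentiableOn).1 (memLp_pi_iff.2 h.memLp)⟩, h.nonzero⟩
  · rintro ⟨h, hne⟩
    have solution := fun θ hθ =>
      (hasDerivAt_sqrt_sin_smul_iff (ω := ω) (μ := μ) hθ).1 (h.hasDerivAt θ hθ)
    have hS : DifferentiableOn ℝ S (Ioo 0 Real.pi) := fun θ hθ =>
      (solution θ hθ).1.differentiableWithinAt
    exact ⟨hS, memLp_pi_iff.1 ((memLp_iff hS).2 h.memLp), fun θ hθ => (solution θ hθ).2, hne⟩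

theorem sin_rpow_mul_sqrt_tan_half (m : ℝ) {θ : ℝ} (hθ : θ ∈ Ioo 0 Real.pi) :
    Real.sin θ ^ (m + 1 / 2) * √(Real.tan (θ / 2)) = Real.sin θ ^ m * √(1 - Real.cos θ) := by
  have sin_pos := Real.sin_pos_of_mem_Ioo hθ
  have cos_half_pos : 0 < Real.cos (θ / 2) :=
    Real.cos_pos_of_mem_Ioo ⟨by linarith [hθ.1, hθ.2], by linarith [hθ.2]⟩
  have sin_mul_tan : Real.sin θ * Real.tan (θ / 2) = 1 - Real.cos θ := by
    obtain ⟨t, rfl⟩ : ∃ t, θ = 2 * t := ⟨θ / 2, by ring⟩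
    rw [mul_div_cancel_left₀ t two_ne_zero] at cos_half_pos ⊢
    rw [Real.tan_eq_sin_div_cos, Real.sin_two_mul, Real.cos_two_mul']
    field_simp
    linear_combination Real.sin_sq_add_cos_sq t
  rw [Real.rpow_add sin_pos, ← Real.sqrt_eq_rpow, mul_assoc, ← Real.sqrt_mul sin_pos.le,
    sin_mul_tan]

theorem sin_rpow_mul_sqrt_cot_half (m : ℝ) {θ : ℝ} (hθ : θ ∈ Ioo 0 Real.pi) :
    Real.sin θ ^ (m + 1 / 2) * √(Real.cot (θ / 2)) = Real.sin θ ^ m * √(1 + Real.cos θ) := by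
  have cot_eq_tan : Real.cot (θ / 2) = Real.tan ((Real.pi - θ) / 2) := by
    rw [sub_div, Real.tan_pi_div_two_sub, Real.tan_inv_eq_cot]
  simpa only [Real.sin_pi_sub, Real.cos_pi_sub, sub_neg_eq_add, cot_eq_tan] using
    sin_rpow_mul_sqrt_tan_half m (pi_sub_mem_Ioo hθ)

theorem sqrt_sin_smul_angularSpinor {θ : ℝ} (hθ : θ ∈ Ioo 0 Real.pi) :
    √(Real.sin θ) • angularSpinor m (fun x => ε * jacobiP n (m + 1 / 2) (m - 1 / 2) x)
        (fun x => -jacobiP n (m - 1 / 2) (m + 1 / 2) x) θ = angularMode m n ε θ := by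
  have sqrt_ne_zero := (Real.sqrt_pos.2 (Real.sin_pos_of_mem_Ioo hθ)).ne'
  refine funext <| Fin.forall_fin_two.2 ⟨?_, ?_⟩ <;>
    simp only [angularSpinor, angularMode, angularFst, angularSnd, Pi.smul_apply,
      Matrix.cons_val_zero, Matrix.cons_val_one, Complex.real_smul, ← Complex.ofReal_mul,
      Complex.ofReal_inj, mul_inv_cancel_left₀ sqrt_ne_zero]
  · linear_combination ε * jacobiP n (m + 1 / 2) (m - 1 / 2) (Real.cos θ) *
      sin_rpow_mul_sqrt_tan_half m hθ
  · linear_combination -jacobiP n (m - 1 / 2) (m + 1 / 2) (Real.cos θ) *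
      sin_rpow_mul_sqrt_cot_half m hθ

theorem eqOn_sqrt_sin_smul_iff {c : ℂ} :
    EqOn (fun θ => √(Real.sin θ) • S θ) (c • angularMode m n ε) (Ioo 0 Real.pi) ↔
      ∀ θ ∈ Ioo 0 Real.pi, S θ = c • angularSpinor m
        (fun x => ε * jacobiP n (m + 1 / 2) (m - 1 / 2) x)
        (fun x => -jacobiP n (m - 1 / 2) (m + 1 / 2) x) θ := by
  refine forall₂_congr fun θ hθ => ?_
  rw [Pi.smul_apply, ← sqrt_sin_smul_angularSpinor hθ, smul_comm]
  exact smul_right_inj (Real.sqrt_pos.2 (Real.sin_pos_of_mem_Ioo hθ)).ne'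

theorem isAngularEigenfunction_zero_iff (hm : 1 / 2 ≤ m ∨ ∃ k : ℤ, m = k + 1 / 2) :
    IsAngularEigenfunction 0 ω μ m z S ↔
      ∃ n : ℕ, 0 ≤ n + 2 * m ∧ ∃ ε : ℝ, (ε = 1 ∨ ε = -1) ∧
        z = ((ε * (n + 1 / 2 + m) : ℝ) : ℂ) ∧ ∃ c : ℂ, c ≠ 0 ∧ ∀ θ ∈ Ioo 0 Real.pi,
          S θ = c • angularSpinor m (fun x => ε * jacobiP n (m + 1 / 2) (m - 1 / 2) x)
            (fun x => -jacobiP n (m - 1 / 2) (m + 1 / 2) x) θ := by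
  rw [isAngularEigenfunction_zero_iff_isReducedSolution, isReducedSolution_and_ne_zero_iff hm]
  simp only [IsModeMultiple, eqOn_sqrt_sin_smul_iff]

theorem isAngularEigenfunction_zero_ofReal_iff (hm : 1 / 2 ≤ m ∨ ∃ k : ℤ, m = k + 1 / 2)
    (hn : 0 ≤ n + 2 * m) (hε : ε = 1 ∨ ε = -1) :
    IsAngularEigenfunction 0 ω μ m ((ε * (n + 1 / 2 + m) : ℝ) : ℂ) S ↔
      ∃ c : ℂ, c ≠ 0 ∧ ∀ θ ∈ Ioo 0 Real.pi,
        S θ = c • angularSpinor m (fun x => ε * jacobiP n (m + 1 / 2) (m - 1 / 2) x)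
          (fun x => -jacobiP n (m - 1 / 2) (m + 1 / 2) x) θ := by
  rw [isAngularEigenfunction_zero_iff hm]
  constructor
  · rintro ⟨k, hk, δ, hδ, heq, hS⟩
    obtain ⟨rfl, hnk⟩ := (mul_eq_mul_iff_of_sign hε hδ (index_add_half_add_pos hn)
      (index_add_half_add_pos hk)).1 (Complex.ofReal_injective heq)
    obtain rfl : n = k := by exact_mod_cast add_right_cancel (add_right_cancel hnk)
    exact hS
  · exact fun hS => ⟨n, hn, ε, hε, rfl, hS⟩

theorem isAngularEigenvalue_zero_iff (hm : 1 / 2 ≤ m ∨ ∃ k : ℤ, m = k + 1 / 2) :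
    IsAngularEigenvalue 0 ω μ m z ↔ ∃ n : ℕ, 0 ≤ n + 2 * m ∧
      (z = ((n + 1 / 2 + m : ℝ) : ℂ) ∨ z = ((-(n + 1 / 2 + m) : ℝ) : ℂ)) := by
  have sign_iff (n : ℕ) : (z = ((n + 1 / 2 + m : ℝ) : ℂ) ∨ z = ((-(n + 1 / 2 + m) : ℝ) : ℂ)) ↔
      ∃ ε : ℝ, (ε = 1 ∨ ε = -1) ∧ z = ((ε * (n + 1 / 2 + m) : ℝ) : ℂ) := by
    simp only [or_and_right, exists_or, exists_eq_left, one_mul, neg_one_mul]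
  simp only [IsAngularEigenvalue, sign_iff]
  constructor
  · rintro ⟨S, hS⟩
    obtain ⟨n, hn, ε, hε, hz, -⟩ := (isAngularEigenfunction_zero_iff hm).1 hS
    exact ⟨n, hn, ε, hε, hz⟩
  · rintro ⟨n, hn, ε, hε, rfl⟩
    exact ⟨_, (isAngularEigenfunction_zero_ofReal_iff hm hn hε).2
      ⟨1, one_ne_zero, fun θ _ => (one_smul ℂ _).symm⟩⟩

end AngularEquation

theorem mul_eq_mul_jacobiP_of_one_add_mul_deriv {n : ℕ} {α β lam x : ℝ} {u v : ℝ → ℝ}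
    (hv : ∀ x, v x = -jacobiP n α β x) (h : (1 + x) * deriv v x = -β * v x - lam * u x) :
    lam * u x = (n + β) * jacobiP n (α + 1) (β - 1) x := by
  have deriv_v : deriv v x = -deriv (jacobiP n α β) x := by rw [funext hv, deriv.fun_neg]
  rw [deriv_v, hv] at h
  linear_combination one_add_mul_deriv_jacobiP n α β x + h

theorem abs_mul_of_sign {ε r : ℝ} (hε : ε = 1 ∨ ε = -1) (hr : 0 ≤ r) : |ε * r| = r := by
  rw [abs_mul, (abs_eq zero_le_one).2 hε, one_mul, abs_of_nonneg hr]

theorem eq_mul_of_sign_mul_eq {ε r p q : ℝ} (hε : ε = 1 ∨ ε = -1) (hr : r ≠ 0)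
    (h : ε * r * p = r * q) : p = ε * q := by
  refine mul_left_cancel₀ hr ?_
  linear_combination ε * h - r * p * mul_self_eq_one_iff.2 hε

theorem mainTheorem7 (a ω μ m : ℝ) (ha : a = 0)
    (hm : 1 / 2 ≤ m ∨ ∃ k : ℤ, m = (k : ℝ) + 1 / 2) :
    {z : ℂ | IsAngularEigenvalue a ω μ m z} =
      {z : ℂ | ∃ n : ℕ, 0 ≤ (n : ℝ) + 2 * m ∧
        (z = (((n : ℝ) + 1 / 2 + m : ℝ) : ℂ) ∨ z = ((-((n : ℝ) + 1 / 2 + m) : ℝ) : ℂ))} ∧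
    ∀ n : ℕ, 0 ≤ (n : ℝ) + 2 * m → ∀ ε : ℝ, (ε = 1 ∨ ε = -1) →
      ∀ lam : ℝ, lam = ε * ((n : ℝ) + 1 / 2 + m) →
        (∀ S : ℝ → Fin 2 → ℂ, IsAngularEigenfunction a ω μ m (lam : ℂ) S ↔
          ∃ c : ℂ, c ≠ 0 ∧ ∀ θ ∈ Set.Ioo 0 Real.pi,
            S θ = c • angularSpinor m
              (fun x => ε * jacobiP n (m + 1 / 2) (m - 1 / 2) x)
              (fun x => -jacobiP n (m - 1 / 2) (m + 1 / 2) x) θ) ∧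
        (∀ u v : ℝ → ℝ, (∀ x, v x = -jacobiP n (m - 1 / 2) (m + 1 / 2) x) →
          (∀ x ∈ Set.Ioo (-1 : ℝ) 1,
            (1 + x) * deriv v x = -(m + 1 / 2) * v x - lam * u x) →
          ∀ x ∈ Set.Ioo (-1 : ℝ) 1,
            lam * u x = |lam| * jacobiP n (m + 1 / 2) (m - 1 / 2) x ∧
            u x = ε * jacobiP n (m + 1 / 2) (m - 1 / 2) x) := by
  subst ha
  refine ⟨Set.ext fun z => isAngularEigenvalue_zero_iff hm, ?_⟩
  rintro n hn ε hε lam rfl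
  refine ⟨fun S => isAngularEigenfunction_zero_ofReal_iff hm hn hε, fun u v hv hu x hx => ?_⟩
  have lam_mul_u : ε * (n + 1 / 2 + m) * u x =
      (n + 1 / 2 + m) * jacobiP n (m + 1 / 2) (m - 1 / 2) x := by
    convert mul_eq_mul_jacobiP_of_one_add_mul_deriv hv (hu x hx) using 2 <;> ring_nf
  have hpos := index_add_half_add_pos hn
  exact ⟨lam_mul_u.trans (by rw [abs_mul_of_sign hε hpos.le]),
    eq_mul_of_sign_mul_eq hε hpos.ne' lam_mul_u⟩
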